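/- Let $(M^m,g)$ and $(N^n,h)$ be smooth Riemannian manifolds with Levi-Civita connections $\nabla$ and $\nabla^h$, and let $\varphi:(M,g)\to(N,h)$ be a smooth isometric immersion, i.e. $h(d\varphi(v),d\varphi(w))=g(v,w)$ for all $v,w\in T_xM$, $x\in M$. Let $\overline\nabla$ be the connection induced by $\nabla^h$ on $\varphi^{-1}TN$, let $B_\varphi(X,Y)=\overline\nabla_X(d\varphi(Y))-d\varphi(\nabla_XY)$ be the second fundamental form, $\tau(\varphi)=\sum_{i=1}^m B_\varphi(e_i,e_i)$ the tension field, and $R^h(U,V)W=\nabla^h_U\nabla^h_VW-\nabla^h_V\nabla^h_UW-\nabla^h_{[U,V]}W$ the curvature tensor of $(N,h)$, where $(e_i)_{i=1}^m$ is a (local) orthonormal frame of $(M,g)$. The map $\varphi$ is called biharmonic if its bitension field $$\tau_2(\varphi)=-\sum_{i=1}^m\big(\overline\nabla_{e_i}\overline\nabla_{e_i}\tau(\varphi)-\overline\nabla_{\nabla_{e_i}e_i}\tau(\varphi)\big)-\sum_{i=1}^mR^h(\tau(\varphi),d\varphi(e_i))d\varphi(e_i)$$ vanishes identically on $M$. Theorem.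 Assume that the tension field is parallel in the normal bundle: $\overline\nabla^\perp_X\tau(\varphi)=0$ for every tangent vector $X$ of $M$, where $\overline\nabla^\perp_X\xi$ is the component of $\overline\nabla_X\xi$ orthogonal to $d\varphi(TM)$. Then $\varphi$ is biharmonic if and only if $$\sum_{k=1}^m R^h(\tau(\varphi),d\varphi(e_k))\,d\varphi(e_k)=\sum_{j,k=1}^m h\big(\tau(\varphi),B_\varphi(e_j,e_k)\big)\,B_\varphi(e_j,e_k)$$ at every point $x$ of $M$, where $(e_k)_{k=1}^m$ is any orthonormal basis of $T_xM$ (neither side depends on the choice). -/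

import Mathlib

open Bundle Manifold Module
open scoped ContDiff

noncomputable section RiemannianSubmanifolds

variable {E : Type*} [NormedAddCommGroup E] [NormedSpace ℝ E] [FiniteDimensional ℝ E]
  {H : Type*} [TopologicalSpace H] (I : ModelWithCorners ℝ E H)
  {M : Type*} [TopologicalSpace M] [ChartedSpace H M] [IsManifold I ∞ M]
  [RiemannianBundle (fun x : M ↦ TangentSpace I x)]
  {E' : Type*} [NormedAddCommGroup E'] [NormedSpace ℝ E'] [FiniteDimensional ℝ E']
  {H' : Type*} [TopologicalSpace H'] (J : ModelWithCorners ℝ E' H')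
  {N : Type*} [TopologicalSpace N] [ChartedSpace H' N] [IsManifold J ∞ N]
  [RiemannianBundle (fun y : N ↦ TangentSpace J y)]

instance instFiniteDimensionalTangentSpace (x : M) : FiniteDimensional ℝ (TangentSpace I x) :=
  inferInstanceAs (FiniteDimensional ℝ E)

/-- A vector field, smooth near `x`, whose value at `x` is `v`: the one with constant coefficients
in the preferred chart at `x`. All the tensors below are defined by evaluating an expression in
vector fields on such extensions of the given tangent vectors; being tensorial, the expressions do
not depend on the extensions. -/
def extendVec {x : M} (v : TangentSpace I x) (x' : M) : TangentSpace I x' :=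
  FiberBundle.extend E (E := fun z : M ↦ TangentSpace I z) (x := x) v x'

/-- The right-hand side of the Koszul formula, which is `2 ⟨∇_X Y, Z⟩`:
`X⟨Y,Z⟩ + Y⟨X,Z⟩ - Z⟨X,Y⟩ + ⟨[X,Y],Z⟩ - ⟨[X,Z],Y⟩ - ⟨[Y,Z],X⟩` at the point `x`. -/
def koszul (X Y Z : Π x : M, TangentSpace I x) (x : M) : ℝ :=
  mvfderiv I (fun z ↦ inner ℝ (Y z) (Z z)) x (X x)
    + mvfderiv I (fun z ↦ inner ℝ (X z) (Z z)) x (Y x)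
    - mvfderiv I (fun z ↦ inner ℝ (X z) (Y z)) x (Z x)
    + inner ℝ (VectorField.mlieBracket I X Y x) (Z x)
    - inner ℝ (VectorField.mlieBracket I X Z x) (Y x)
    - inner ℝ (VectorField.mlieBracket I Y Z x) (X x)

/-- The Levi-Civita connection: `leviCivita I Y x v` is `(∇_v Y)(x)`. It is the vector whose inner
product with each `z ∈ T_x M` is half of the Koszul expression in (extensions of) `v`, `Y`, `z`,
written out in an orthonormal basis of `T_x M`. -/
def leviCivita (Y : Π x : M, TangentSpace I x) (x : M) (v : TangentSpace I x) :
    TangentSpace I x :=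
  ∑ i, ((1 / 2 : ℝ) * koszul I (extendVec I v) Y
      (extendVec I (stdOrthonormalBasis ℝ (TangentSpace I x) i)) x) •
    stdOrthonormalBasis ℝ (TangentSpace I x) i

/-- The curvature tensor `R(u, v) w = ∇_U ∇_V W - ∇_V ∇_U W - ∇_{[U,V]} W`. -/
def curvature (x : M) (u v w : TangentSpace I x) : TangentSpace I x :=
  leviCivita I (fun z ↦ leviCivita I (extendVec I w) z (extendVec I v z)) x u
    - leviCivita I (fun z ↦ leviCivita I (extendVec I w) z (extendVec I u z)) x v
    - leviCivita I (extendVec I w) x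
        (VectorField.mlieBracket I (extendVec I u) (extendVec I v) x)

/-- The connection `∇̄` induced on `φ⁻¹TN` by the Levi-Civita connection of `N`:
`pullbackConnection I J φ V x v` is `(∇̄_v V)(x)` for a vector field `V` along `φ`.
If `V = ∑ Vⁱ (sᵢ ∘ φ)` for the coordinate frame `(sᵢ)` of the preferred chart at `φ x`, then this is
`∑ dVⁱ(v) sᵢ + ∑ Vⁱ ∇_{dφ v} sᵢ`; the field `extendVec J (V x)` is `∑ Vⁱ(x) sᵢ`. -/
def pullbackConnection (φ : M → N) (V : Π x : M, TangentSpace J (φ x)) (x : M)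
    (v : TangentSpace I x) : TangentSpace J (φ x) :=
  (trivializationAt E' (fun y : N ↦ TangentSpace J y) (φ x)).symm (φ x)
      (mvfderiv I (fun z ↦ (trivializationAt E' (fun y : N ↦ TangentSpace J y) (φ x)
        (TotalSpace.mk' E' (φ z) (V z))).2) x v)
    + leviCivita J (extendVec J (V x)) (φ x) (mfderiv I J φ x v)

/-- The second fundamental form `B(v, w) = ∇̄_v (dφ(W)) - dφ(∇_v W)`, `W` an extension of `w`. -/
def secondFundamentalForm (φ : M → N) (x : M) (v w : TangentSpace I x) : TangentSpace J (φ x) :=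
  pullbackConnection I J φ (fun z ↦ mfderiv I J φ z (extendVec I w z)) x v
    - mfderiv I J φ x (leviCivita I (extendVec I w) x v)

/-- The tension field `τ(φ) = ∑ B(eᵢ, eᵢ)`, `(eᵢ)` an orthonormal basis of `T_x M`. -/
def tensionField (φ : M → N) (x : M) : TangentSpace J (φ x) :=
  ∑ i, secondFundamentalForm I J φ x (stdOrthonormalBasis ℝ (TangentSpace I x) i)
    (stdOrthonormalBasis ℝ (TangentSpace I x) i)

/-- The second covariant derivative `∇̄_v ∇̄_W V - ∇̄_{∇_v W} V`, `W` an extension of `w`. -/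
def secondCovDeriv (φ : M → N) (V : Π x : M, TangentSpace J (φ x)) (x : M)
    (v w : TangentSpace I x) : TangentSpace J (φ x) :=
  pullbackConnection I J φ (fun z ↦ pullbackConnection I J φ V z (extendVec I w z)) x v
    - pullbackConnection I J φ V x (leviCivita I (extendVec I w) x v)

/-- The rough Laplacian `Δ̄ V = - ∑ (∇̄_{eᵢ} ∇̄_{eᵢ} V - ∇̄_{∇_{eᵢ} eᵢ} V)`. -/
def roughLaplacian (φ : M → N) (V : Π x : M, TangentSpace J (φ x)) (x : M) :
    TangentSpace J (φ x) :=
  -∑ i, secondCovDeriv I J φ V x (stdOrthonormalBasis ℝ (TangentSpace I x) i)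
    (stdOrthonormalBasis ℝ (TangentSpace I x) i)

/-- The operator `𝓡(V) = ∑ R^h(V, dφ(eᵢ)) dφ(eᵢ)`. -/
def curvatureOperator (φ : M → N) (V : Π x : M, TangentSpace J (φ x)) (x : M) :
    TangentSpace J (φ x) :=
  ∑ i, curvature J (φ x) (V x)
    (mfderiv I J φ x (stdOrthonormalBasis ℝ (TangentSpace I x) i))
    (mfderiv I J φ x (stdOrthonormalBasis ℝ (TangentSpace I x) i))

/-- The bitension field `τ₂(φ) = Δ̄ τ(φ) - 𝓡(τ(φ))`. -/
def bitensionField (φ : M → N) (x : M) : TangentSpace J (φ x) :=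
  roughLaplacian I J φ (tensionField I J φ) x - curvatureOperator I J φ (tensionField I J φ) x

/-- A map is biharmonic if its bitension field vanishes. -/
def IsBiharmonic (φ : M → N) : Prop := ∀ x, bitensionField I J φ x = 0

/-- Smooth isometric immersions: `h(dφ(v), dφ(w)) = g(v, w)`. -/
structure IsIsometricImmersion (φ : M → N) : Prop where
  contMDiff : ContMDiff I J ∞ φ
  inner_mfderiv : ∀ (x : M) (v w : TangentSpace I x),
    inner ℝ (mfderiv I J φ x v : TangentSpace J (φ x)) (mfderiv I J φ x w) = inner ℝ v w

/-- The normal space `T_x^⊥ M`, the orthogonal complement of `dφ(T_x M)` in `T_{φ(x)} N`. -/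
def normalSpace (φ : M → N) (x : M) : Submodule ℝ (TangentSpace J (φ x)) :=
  (LinearMap.range (mfderiv I J φ x).toLinearMap)ᗮ

/-- The normal connection `∇̄^⊥_v ξ = (∇̄_v ξ)^⊥`. -/
def normalConnection (φ : M → N) (ξ : Π x : M, TangentSpace J (φ x)) (x : M)
    (v : TangentSpace I x) : TangentSpace J (φ x) :=
  (normalSpace I J φ x).starProjection (pullbackConnection I J φ ξ x v)

end RiemannianSubmanifolds

/-!
All objects in the theorem are local, so both manifolds are read in charts: the immersion becomes a
smooth map `f` between open subsets of two vector spaces carrying metrics `g` and `h`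
(`isLocalIsometricImmersion_coordMap`), and connection, second fundamental form, tension field and
curvature become their classical expressions in Christoffel symbols (`toCoord_leviCivita`,
`toCoord_pullbackConnection`, `toCoord_secondFundamentalForm`, `coordFieldAlong_tensionField`,
`toCoord_curvature`, `toCoord_secondCovDeriv`).

Write `τ` for the tension field and `B` for the second fundamental form. Both are normal to the
immersion. Since `τ` is parallel in the normal bundle, its derivative is tangential,
`∇_v τ = df(S v)` for a field of endomorphisms `S`. Differentiating `h(τ, df w) = 0` gives
`g(S v, w) = -h(τ, B(v, w))`, so `S` is self-adjoint and `tr S = -|τ|²`, which is locally constant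
because `v(|τ|²) = 2 h(df(S v), τ) = 0`. One more derivative gives
`∇²_{v,w} τ = B(v, S w) + df((∇_v S) w)`, and, for an orthonormal basis `e`,

* the normal part of `∑ ∇²_{e_i,e_i} τ` is `∑ B(e_i, S e_i) = -∑ h(τ, B(e_j, e_k)) B(e_j, e_k)`;
* the tangential part of `∑ ∇²_{e_i,e_i} τ` is the divergence of `S`. Since `∇S` is self-adjoint and
  trace-free, the Ricci identity `∇²_{v,w} τ - ∇²_{w,v} τ = R(df v, df w) τ` and the pair symmetry
  of `R` show that it is also the tangential part of the curvature term `∑ R(τ, df e_i) df e_i`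
  (`trace_covDerivEnd_tension`, `inner_sum_localSecondCovDeriv`).

With `T` this tangential part, `K` the normal part of the curvature term and
`Q = ∑ h(τ, B(e_j, e_k)) B(e_j, e_k)`, the bitension field is therefore `(Q - K) - 2 T`, while the
claimed equation reads `K + T = Q`. Both say that `T = 0` and `K = Q`
(`neg_sum_localSecondCovDeriv_eq_iff`).
-/

/-! ### Local Riemannian metrics on a vector space -/

noncomputable section LocalMetric

set_option maxSynthPendingDepth 3

-- The fibrewise norms of Riemannian bundles play no role in this section, and their instances,
-- which match every type, slow down the search for norms on spaces of linear maps.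
attribute [-instance]
  instNormedAddCommGroupOfRiemannianBundleOfIsTopologicalAddGroupOfContinuousConstSMulReal
  instInnerProductSpaceReal

open ContinuousLinearMap

variable {E : Type*} [NormedAddCommGroup E] [NormedSpace ℝ E]

/-- A Riemannian metric on the open subset `Ω` of the vector space `E`, as a smooth field of
positive definite symmetric bilinear forms. This is how a metric on a manifold reads in a chart. -/
structure IsLocalMetric (g : E → E →L[ℝ] E →L[ℝ] ℝ) (Ω : Set E) : Prop where
  isOpen : IsOpen Ω
  contDiffAt : ∀ p ∈ Ω, ContDiffAt ℝ ∞ g p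
  symm : ∀ p ∈ Ω, ∀ u v, g p u v = g p v u
  pos : ∀ p ∈ Ω, ∀ u, u ≠ 0 → 0 < g p u u

/-- The trilinear form `∂_u g(v, w) + ∂_v g(u, w) - ∂_w g(u, v)` of the first derivatives of `g`. -/
def christoffelFirst (g : E → E →L[ℝ] E →L[ℝ] ℝ) (p : E) : E →L[ℝ] E →L[ℝ] E →L[ℝ] ℝ :=
  fderiv ℝ g p + (fderiv ℝ g p).flip
    - ((flipₗᵢ ℝ E E ℝ).toContinuousLinearEquiv : _ →L[ℝ] _) ∘L (fderiv ℝ g p).flip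

/-- The Christoffel symbol of `g`, as a bilinear map `Γ p : E → E → E`; the coordinate expression
of the Levi-Civita connection is `∇_u Y = ∂_u Y + Γ(u, Y)`. -/
def christoffel (g : E → E →L[ℝ] E →L[ℝ] ℝ) (p : E) : E →L[ℝ] E →L[ℝ] E :=
  (compL ℝ E (E →L[ℝ] ℝ) E (g p).inverse) ∘L ((1 / 2 : ℝ) • christoffelFirst g p)

/-- The coordinate expression `∂_u Γ(v, w) - ∂_v Γ(u, w) + Γ(u, Γ(v, w)) - Γ(v, Γ(u, w))` of the
curvature tensor of the connection with Christoffel symbol `Γ`. -/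
def riemann (Γ : E → E →L[ℝ] E →L[ℝ] E) (p u v w : E) : E :=
  fderiv ℝ Γ p u v w - fderiv ℝ Γ p v u w + Γ p u (Γ p v w) - Γ p v (Γ p u w)

lemma christoffelFirst_apply (g : E → E →L[ℝ] E →L[ℝ] ℝ) (p u v w : E) :
    christoffelFirst g p u v w =
      fderiv ℝ g p u v w + fderiv ℝ g p v u w - fderiv ℝ g p w u v := by
  simp [christoffelFirst]

lemma riemann_swap (Γ : E → E →L[ℝ] E →L[ℝ] E) (p u v w : E) :
    riemann Γ p u v w = -riemann Γ p v u w := by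
  simp only [riemann]; abel

namespace IsLocalMetric

variable {g : E → E →L[ℝ] E →L[ℝ] ℝ} {Ω : Set E} {p : E}

lemma ext (hg : IsLocalMetric g Ω) (hp : p ∈ Ω) {u v : E} (h : ∀ w, g p u w = g p v w) :
    u = v := by
  by_contra huv
  have := hg.pos p hp (u - v) (sub_ne_zero.2 huv)
  simp [h] at this

lemma mem_nhds (hg : IsLocalMetric g Ω) (hp : p ∈ Ω) : Ω ∈ nhds p := hg.isOpen.mem_nhds hp

lemma differentiableAt (hg : IsLocalMetric g Ω) (hp : p ∈ Ω) : DifferentiableAt ℝ g p :=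
  (hg.contDiffAt p hp).differentiableAt (by simp)

lemma fderiv_symm (hg : IsLocalMetric g Ω) (hp : p ∈ Ω) (u v w : E) :
    fderiv ℝ g p u v w = fderiv ℝ g p u w v := by
  have hd := (hg.differentiableAt hp).hasFDerivAt
  have h1 : HasFDerivAt (fun q ↦ g q v w) _ p :=
    (hd.clm_apply (hasFDerivAt_const v p)).clm_apply (hasFDerivAt_const w p)
  have h2 : HasFDerivAt (fun q ↦ g q w v) _ p :=
    (hd.clm_apply (hasFDerivAt_const w p)).clm_apply (hasFDerivAt_const v p)
  have h3 : (fun q ↦ g q v w) =ᶠ[nhds p] fun q ↦ g q w v :=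
    Filter.eventually_of_mem (hg.mem_nhds hp) fun q hq ↦ hg.symm q hq v w
  have := DFunLike.congr_fun (h1.unique (h2.congr_of_eventuallyEq h3)) u
  simpa using this

variable [FiniteDimensional ℝ E]

lemma isInvertible (hg : IsLocalMetric g Ω) (hp : p ∈ Ω) : (g p).IsInvertible := by
  have hinj : Function.Injective (g p : E →ₗ[ℝ] E →L[ℝ] ℝ) := fun u v h ↦
    hg.ext hp fun w ↦ DFunLike.congr_fun h w
  have hdim : finrank ℝ E = finrank ℝ (E →L[ℝ] ℝ) := by
    rw [← (LinearMap.toContinuousLinearMap (𝕜 := ℝ) (E := E) (F' := ℝ)).finrank_eq]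
    exact Subspace.dual_finrank_eq.symm
  refine ⟨(LinearEquiv.ofInjectiveOfFinrankEq _ hinj hdim).toContinuousLinearEquiv, ?_⟩
  ext; rfl

lemma apply_inverse (hg : IsLocalMetric g Ω) (hp : p ∈ Ω) (ℓ : E →L[ℝ] ℝ) (w : E) :
    g p ((g p).inverse ℓ) w = ℓ w := by
  rw [(hg.isInvertible hp).self_apply_inverse]

lemma contDiffAt_inverse (hg : IsLocalMetric g Ω) (hp : p ∈ Ω) :
    ContDiffAt ℝ ∞ (fun q ↦ (g q).inverse) p := by
  have := FiniteDimensional.complete ℝ E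
  exact (hg.isInvertible hp).contDiffAt_map_inverse.comp p (hg.contDiffAt p hp)

lemma apply_christoffel (hg : IsLocalMetric g Ω) (hp : p ∈ Ω) (u v w : E) :
    g p (christoffel g p u v) w =
      (1 / 2) * (fderiv ℝ g p u v w + fderiv ℝ g p v u w - fderiv ℝ g p w u v) := by
  rw [← christoffelFirst_apply]
  simp [christoffel, hg.apply_inverse hp]

lemma christoffel_symm (hg : IsLocalMetric g Ω) (hp : p ∈ Ω) (u v : E) :
    christoffel g p u v = christoffel g p v u :=
  hg.ext hp fun w ↦ by
    rw [hg.apply_christoffel hp, hg.apply_christoffel hp, hg.fderiv_symm hp w u v]; ring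

/-- The Levi-Civita connection is metric: `∂_u g(v, w) = g(Γ(u, v), w) + g(v, Γ(u, w))`. -/
lemma fderiv_eq (hg : IsLocalMetric g Ω) (hp : p ∈ Ω) (u v w : E) :
    fderiv ℝ g p u v w = g p (christoffel g p u v) w + g p v (christoffel g p u w) := by
  rw [hg.symm p hp v, hg.apply_christoffel hp, hg.apply_christoffel hp, hg.fderiv_symm hp u w v]
  ring

lemma contDiffAt_christoffel (hg : IsLocalMetric g Ω) (hp : p ∈ Ω) :
    ContDiffAt ℝ ∞ (christoffel g) p := by
  have hd : ContDiffAt ℝ ∞ (fderiv ℝ g) p := (hg.contDiffAt p hp).fderiv_right (by simp)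
  have hf : ContDiffAt ℝ ∞ (fun q ↦ (fderiv ℝ g q).flip) p :=
    (flipₗᵢ ℝ E E (E →L[ℝ] ℝ)).contDiff.contDiffAt.comp p hd
  have h1 : ContDiffAt ℝ ∞ (christoffelFirst g) p :=
    (hd.add hf).sub (contDiffAt_const.clm_comp hf)
  exact ((compL ℝ E (E →L[ℝ] ℝ) E).contDiff.contDiffAt.comp p
    (hg.contDiffAt_inverse hp)).clm_comp (h1.const_smul (1 / 2 : ℝ))

lemma differentiableAt_christoffel (hg : IsLocalMetric g Ω) (hp : p ∈ Ω) :
    DifferentiableAt ℝ (christoffel g) p :=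
  (hg.contDiffAt_christoffel hp).differentiableAt (by simp)

lemma fderiv_christoffel_symm (hg : IsLocalMetric g Ω) (hp : p ∈ Ω) (u v w : E) :
    fderiv ℝ (christoffel g) p u v w = fderiv ℝ (christoffel g) p u w v := by
  have hd := (hg.differentiableAt_christoffel hp).hasFDerivAt
  have h1 : HasFDerivAt (fun q ↦ christoffel g q v w) _ p :=
    (hd.clm_apply (hasFDerivAt_const v p)).clm_apply (hasFDerivAt_const w p)
  have h2 : HasFDerivAt (fun q ↦ christoffel g q w v) _ p :=
    (hd.clm_apply (hasFDerivAt_const w p)).clm_apply (hasFDerivAt_const v p)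
  have h3 : (fun q ↦ christoffel g q v w) =ᶠ[nhds p] fun q ↦ christoffel g q w v :=
    Filter.eventually_of_mem (hg.mem_nhds hp) fun q hq ↦ hg.christoffel_symm hq v w
  have := DFunLike.congr_fun (h1.unique (h2.congr_of_eventuallyEq h3)) u
  simpa using this

lemma riemann_bianchi (hg : IsLocalMetric g Ω) (hp : p ∈ Ω) (u v w : E) :
    riemann (christoffel g) p u v w + riemann (christoffel g) p v w u
      + riemann (christoffel g) p w u v = 0 := by
  simp only [riemann, hg.fderiv_christoffel_symm hp u w v, hg.fderiv_christoffel_symm hp v w u,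
    hg.fderiv_christoffel_symm hp w v u, hg.christoffel_symm hp w v, hg.christoffel_symm hp w u,
    hg.christoffel_symm hp v u]
  abel

lemma riemann_inner_swap (hg : IsLocalMetric g Ω) (hp : p ∈ Ω) (u v w z : E) :
    g p (riemann (christoffel g) p u v w) z = -g p (riemann (christoffel g) p u v z) w := by
  have hd := (hg.differentiableAt hp).hasFDerivAt
  have hΓ := (hg.differentiableAt_christoffel hp).hasFDerivAt
  have hdd : HasFDerivAt (fderiv ℝ g) (fderiv ℝ (fderiv ℝ g) p) p :=
    (((hg.contDiffAt p hp).fderiv_right (m := ∞) (by simp)).differentiableAt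
      (by simp)).hasFDerivAt
  -- Differentiate the identity `∂_b g(w, z) = g(Γ(b, w), z) + g(w, Γ(b, z))` in the direction `a`.
  have key : ∀ a b, fderiv ℝ (fderiv ℝ g) p a b w z =
      fderiv ℝ g p a (christoffel g p b w) z + g p (fderiv ℝ (christoffel g) p a b w) z
        + (fderiv ℝ g p a w (christoffel g p b z) + g p w (fderiv ℝ (christoffel g) p a b z)) := by
    intro a b
    have h1 : HasFDerivAt (fun q ↦ fderiv ℝ g q b w z) _ p :=
      ((hdd.clm_apply (hasFDerivAt_const b p)).clm_apply (hasFDerivAt_const w p)).clm_apply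
        (hasFDerivAt_const z p)
    have h2 : HasFDerivAt (fun q ↦ g q (christoffel g q b w) z + g q w (christoffel g q b z)) _ p :=
      ((hd.clm_apply ((hΓ.clm_apply (hasFDerivAt_const b p)).clm_apply
        (hasFDerivAt_const w p))).clm_apply (hasFDerivAt_const z p)).add
      ((hd.clm_apply (hasFDerivAt_const w p)).clm_apply ((hΓ.clm_apply
        (hasFDerivAt_const b p)).clm_apply (hasFDerivAt_const z p)))
    have h3 : (fun q ↦ fderiv ℝ g q b w z) =ᶠ[nhds p]
        fun q ↦ g q (christoffel g q b w) z + g q w (christoffel g q b z) :=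
      Filter.eventually_of_mem (hg.mem_nhds hp) fun q hq ↦ hg.fderiv_eq hq b w z
    have := DFunLike.congr_fun (h1.unique (h2.congr_of_eventuallyEq h3)) a
    simp at this
    linarith
  have hsymm : fderiv ℝ (fderiv ℝ g) p u v = fderiv ℝ (fderiv ℝ g) p v u :=
    (hg.contDiffAt p hp).isSymmSndFDerivAt
      (by rw [minSmoothness_of_isRCLikeNormedField]; exact ENat.LEInfty.out) u v
  have h1 := key u v
  rw [hsymm, key v u] at h1
  simp only [hg.fderiv_eq hp] at h1
  rw [hg.symm p hp _ w]
  simp only [riemann, map_add, map_sub, add_apply, sub_apply]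
  linarith

/-- The pair symmetry of the curvature tensor, by the usual octahedron argument from its
antisymmetries and the first Bianchi identity. -/
lemma riemann_pair_symm (hg : IsLocalMetric g Ω) (hp : p ∈ Ω) (u v w z : E) :
    g p (riemann (christoffel g) p u v w) z = g p (riemann (christoffel g) p w z u) v := by
  have hb : ∀ a b c d, g p (riemann (christoffel g) p a b c) d
      + g p (riemann (christoffel g) p b c a) d + g p (riemann (christoffel g) p c a b) d = 0 := by
    intro a b c d
    have := congrArg (fun t ↦ g p t d) (hg.riemann_bianchi hp a b c)
    simpa using this
  have hs : ∀ a b c d, g p (riemann (christoffel g) p a b c) d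
      = -g p (riemann (christoffel g) p b a c) d := by
    intro a b c d
    rw [riemann_swap]; simp
  have ha := hg.riemann_inner_swap hp
  linarith [hb u v w z, hb v w z u, hb w z u v, hb z u v w, hs u v w z, hs v w u z, hs w u v z,
    ha u v w z, ha v w u z, ha w u v z, hs z u v w, hs w z u v, hs v z w u, hs u z v w,
    ha w z u v, ha z u w v, ha z u v w, ha z v w u, ha v z w u, hs z v w u, hs u w z v, hs w u z v,
    ha u w z v, ha v w z u, hs v w z u, hs w v z u, hs v u z w, ha v u z w]

end IsLocalMetric

end LocalMetric

/-! ### Maps between vector spaces with local metrics -/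

noncomputable section LocalImmersion

set_option maxSynthPendingDepth 3

attribute [-instance]
  instNormedAddCommGroupOfRiemannianBundleOfIsTopologicalAddGroupOfContinuousConstSMulReal
  instInnerProductSpaceReal

open ContinuousLinearMap

variable {E : Type*} [NormedAddCommGroup E] [NormedSpace ℝ E]
  {E' : Type*} [NormedAddCommGroup E'] [NormedSpace ℝ E']

/-- The covariant derivative `∂V + Γ(∂f, V)` of a vector field `V` along the map `f : E → E'`,
for the connection on `E'` with Christoffel symbol `Γ`. -/
def covDerivAlong (Γ : E' → E' →L[ℝ] E' →L[ℝ] E') (f V : E → E') (p : E) : E →L[ℝ] E' :=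
  fderiv ℝ V p + (Γ (f p)).flip (V p) ∘L fderiv ℝ f p

/-- The second fundamental form `∂_u ∂_v f + Γ'(∂_u f, ∂_v f) - ∂f(Γ(u, v))` of the map `f`, for
connections on `E` and `E'` with Christoffel symbols `Γ` and `Γ'`. -/
def localSecondForm (Γ : E → E →L[ℝ] E →L[ℝ] E) (Γ' : E' → E' →L[ℝ] E' →L[ℝ] E') (f : E → E')
    (p u v : E) : E' :=
  fderiv ℝ (fderiv ℝ f) p u v + Γ' (f p) (fderiv ℝ f p u) (fderiv ℝ f p v)
    - fderiv ℝ f p (Γ p u v)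

/-- The trace of the second fundamental form of `f` with respect to `g`, written in an arbitrary
basis `b` with dual basis `(bⁱ)` as `∑ B(bᵢ, g⁻¹ bⁱ)`. No orthonormal frame is involved, so that
smoothness in `p` is apparent. -/
def localTension {ι : Type*} [Fintype ι] [FiniteDimensional ℝ E] (b : Basis ι ℝ E)
    (g : E → E →L[ℝ] E →L[ℝ] ℝ) (Γ' : E' → E' →L[ℝ] E' →L[ℝ] E') (f : E → E') (p : E) : E' :=
  ∑ i, localSecondForm (christoffel g) Γ' f p (b i)
    ((g p).inverse (LinearMap.toContinuousLinearMap (b.coord i)))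

lemma covDerivAlong_apply (Γ : E' → E' →L[ℝ] E' →L[ℝ] E') (f V : E → E') (p u : E) :
    covDerivAlong Γ f V p u = fderiv ℝ V p u + Γ (f p) (fderiv ℝ f p u) (V p) := by
  simp [covDerivAlong]

/-- A smooth map `f` from an open set with metric `g` to one with metric `h` such that `f^* h = g`,
as an isometric immersion reads in charts. -/
structure IsLocalIsometricImmersion (g : E → E →L[ℝ] E →L[ℝ] ℝ) (Ω : Set E)
    (h : E' → E' →L[ℝ] E' →L[ℝ] ℝ) (Ω' : Set E') (f : E → E') : Prop where
  source : IsLocalMetric g Ω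
  target : IsLocalMetric h Ω'
  mapsTo : Set.MapsTo f Ω Ω'
  contDiffAt : ∀ p ∈ Ω, ContDiffAt ℝ ∞ f p
  isometry : ∀ p ∈ Ω, ∀ u v, h (f p) (fderiv ℝ f p u) (fderiv ℝ f p v) = g p u v

lemma sum_coord_eq_trace {ι : Type*} [Fintype ι] (b : Basis ι ℝ E) (T : E →ₗ[ℝ] E) :
    ∑ i, b.coord i (T (b i)) = LinearMap.trace ℝ E T := by
  classical
  rw [LinearMap.trace_eq_matrix_trace ℝ b, Matrix.trace]
  simp [LinearMap.toMatrix_apply]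

/-- The commutator of two covariant derivatives along a map is the curvature of the target. -/
lemma covDerivAlong_comm [FiniteDimensional ℝ E'] {h : E' → E' →L[ℝ] E' →L[ℝ] ℝ} {Ω' : Set E'}
    (hh : IsLocalMetric h Ω') {f V : E → E'} {p : E} (hp : f p ∈ Ω')
    (hf : ContDiffAt ℝ ∞ f p) (hV : ContDiffAt ℝ ∞ V p) (v w : E) :
    covDerivAlong (christoffel h) f (fun q ↦ covDerivAlong (christoffel h) f V q w) p v
      - covDerivAlong (christoffel h) f (fun q ↦ covDerivAlong (christoffel h) f V q v) p w
    = riemann (christoffel h) (f p) (fderiv ℝ f p v) (fderiv ℝ f p w) (V p) := by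
  have hΓ : HasFDerivAt (fun q ↦ christoffel h (f q)) _ p :=
    (hh.differentiableAt_christoffel hp).hasFDerivAt.comp p
      (hf.differentiableAt (by simp)).hasFDerivAt
  have hVd := (hV.differentiableAt (by simp)).hasFDerivAt
  have hfd : HasFDerivAt (fderiv ℝ f) _ p :=
    ((hf.fderiv_right (m := ∞) (by simp)).differentiableAt (by simp)).hasFDerivAt
  have hVdd : HasFDerivAt (fderiv ℝ V) _ p :=
    ((hV.fderiv_right (m := ∞) (by simp)).differentiableAt (by simp)).hasFDerivAt
  have key : ∀ a b, fderiv ℝ (fun q ↦ covDerivAlong (christoffel h) f V q b) p a =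
      fderiv ℝ (fderiv ℝ V) p a b
        + fderiv ℝ (christoffel h) (f p) (fderiv ℝ f p a) (fderiv ℝ f p b) (V p)
        + christoffel h (f p) (fderiv ℝ (fderiv ℝ f) p a b) (V p)
        + christoffel h (f p) (fderiv ℝ f p b) (fderiv ℝ V p a) := by
    intro a b
    simp only [covDerivAlong_apply]
    have h1 : HasFDerivAt (fun q ↦ fderiv ℝ V q b
        + christoffel h (f q) (fderiv ℝ f q b) (V q)) _ p :=
      (hVdd.clm_apply (hasFDerivAt_const b p)).add
        ((hΓ.clm_apply (hfd.clm_apply (hasFDerivAt_const b p))).clm_apply hVd)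
    rw [h1.fderiv]
    simp
    abel
  have h2 : minSmoothness ℝ 2 ≤ ∞ := by
    rw [minSmoothness_of_isRCLikeNormedField]; exact ENat.LEInfty.out
  have hsf : fderiv ℝ (fderiv ℝ f) p v w = fderiv ℝ (fderiv ℝ f) p w v :=
    hf.isSymmSndFDerivAt h2 v w
  have hsV : fderiv ℝ (fderiv ℝ V) p v w = fderiv ℝ (fderiv ℝ V) p w v :=
    hV.isSymmSndFDerivAt h2 v w
  rw [covDerivAlong_apply _ f fun q ↦ covDerivAlong (christoffel h) f V q w,
    covDerivAlong_apply _ f fun q ↦ covDerivAlong (christoffel h) f V q v, key, key, hsf, hsV]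
  simp only [covDerivAlong_apply, riemann, map_add]
  abel

namespace IsLocalIsometricImmersion

variable {g : E → E →L[ℝ] E →L[ℝ] ℝ} {Ω : Set E} {h : E' → E' →L[ℝ] E' →L[ℝ] ℝ}
  {Ω' : Set E'} {f : E → E'} {p : E}

lemma differentiableAt (H : IsLocalIsometricImmersion g Ω h Ω' f) (hp : p ∈ Ω) :
    DifferentiableAt ℝ f p :=
  (H.contDiffAt p hp).differentiableAt (by simp)

lemma contDiffAt_fderiv (H : IsLocalIsometricImmersion g Ω h Ω' f) (hp : p ∈ Ω) :
    ContDiffAt ℝ ∞ (fderiv ℝ f) p :=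
  (H.contDiffAt p hp).fderiv_right (by simp)

/-- The Gauss formula. -/
lemma covDerivAlong_fderiv_apply (H : IsLocalIsometricImmersion g Ω h Ω' f) (hp : p ∈ Ω)
    {W : E → E} (hW : DifferentiableAt ℝ W p) (u : E) :
    covDerivAlong (christoffel h) f (fun q ↦ fderiv ℝ f q (W q)) p u =
      localSecondForm (christoffel g) (christoffel h) f p u (W p)
        + fderiv ℝ f p (fderiv ℝ W p u + christoffel g p u (W p)) := by
  have hfd := ((H.contDiffAt_fderiv hp).differentiableAt (by simp)).hasFDerivAt
  have h1 : HasFDerivAt (fun q ↦ fderiv ℝ f q (W q)) _ p := hfd.clm_apply hW.hasFDerivAt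
  rw [covDerivAlong_apply, h1.fderiv, localSecondForm]
  simp
  abel

variable [FiniteDimensional ℝ E']

lemma contDiffAt_christoffel_comp (H : IsLocalIsometricImmersion g Ω h Ω' f) (hp : p ∈ Ω) :
    ContDiffAt ℝ ∞ (fun q ↦ christoffel h (f q)) p :=
  (H.target.contDiffAt_christoffel (H.mapsTo hp)).comp p (H.contDiffAt p hp)

lemma contDiffAt_covDerivAlong (H : IsLocalIsometricImmersion g Ω h Ω' f) (hp : p ∈ Ω)
    {V : E → E'} (hV : ContDiffAt ℝ ∞ V p) :
    ContDiffAt ℝ ∞ (covDerivAlong (christoffel h) f V) p :=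
  (hV.fderiv_right (by simp)).add
    ((((flipₗᵢ ℝ E' E' E').contDiff.contDiffAt.comp p
      (H.contDiffAt_christoffel_comp hp)).clm_apply hV).clm_comp (H.contDiffAt_fderiv hp))

/-- The induced connection along `f` is metric. -/
lemma fderiv_inner (H : IsLocalIsometricImmersion g Ω h Ω' f) (hp : p ∈ Ω) {V W : E → E'}
    (hV : DifferentiableAt ℝ V p) (hW : DifferentiableAt ℝ W p) (u : E) :
    fderiv ℝ (fun q ↦ h (f q) (V q) (W q)) p u =
      h (f p) (covDerivAlong (christoffel h) f V p u) (W p)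
        + h (f p) (V p) (covDerivAlong (christoffel h) f W p u) := by
  have hh : HasFDerivAt (fun q ↦ h (f q)) _ p :=
    (H.target.differentiableAt (H.mapsTo hp)).hasFDerivAt.comp p (H.differentiableAt hp).hasFDerivAt
  have h1 : HasFDerivAt (fun q ↦ h (f q) (V q) (W q)) _ p :=
    (hh.clm_apply hV.hasFDerivAt).clm_apply hW.hasFDerivAt
  rw [h1.fderiv]
  simp [covDerivAlong_apply, H.target.fderiv_eq (H.mapsTo hp)]
  abel

variable [FiniteDimensional ℝ E]

lemma localSecondForm_symm (H : IsLocalIsometricImmersion g Ω h Ω' f) (hp : p ∈ Ω) (u v : E) :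
    localSecondForm (christoffel g) (christoffel h) f p u v =
      localSecondForm (christoffel g) (christoffel h) f p v u := by
  have hs : fderiv ℝ (fderiv ℝ f) p u v = fderiv ℝ (fderiv ℝ f) p v u :=
    (H.contDiffAt p hp).isSymmSndFDerivAt
      (by rw [minSmoothness_of_isRCLikeNormedField]; exact ENat.LEInfty.out) u v
  rw [localSecondForm, localSecondForm, hs, H.target.christoffel_symm (H.mapsTo hp),
    H.source.christoffel_symm hp]

/-- The second fundamental form of an isometric immersion is normal: `⟨B(u, v), df(w)⟩` is
symmetric in `u, v` and antisymmetric in `v, w`. -/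
lemma inner_localSecondForm_fderiv (H : IsLocalIsometricImmersion g Ω h Ω' f) (hp : p ∈ Ω)
    (u v w : E) :
    h (f p) (localSecondForm (christoffel g) (christoffel h) f p u v) (fderiv ℝ f p w) = 0 := by
  have anti : ∀ a b c,
      h (f p) (localSecondForm (christoffel g) (christoffel h) f p a b) (fderiv ℝ f p c)
      = -h (f p) (localSecondForm (christoffel g) (christoffel h) f p a c) (fderiv ℝ f p b) := by
    intro a b c
    have hd : ∀ x : E, DifferentiableAt ℝ (fun q ↦ fderiv ℝ f q x) p := fun x ↦
      ((H.contDiffAt_fderiv hp).clm_apply contDiffAt_const).differentiableAt (by simp)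
    have h1 := H.fderiv_inner hp (hd b) (hd c) a
    have h2 : (fun q ↦ h (f q) (fderiv ℝ f q b) (fderiv ℝ f q c)) =ᶠ[nhds p] fun q ↦ g q b c :=
      Filter.eventually_of_mem (H.source.mem_nhds hp) fun q hq ↦ H.isometry q hq b c
    have h3 : HasFDerivAt (fun q ↦ g q b c) _ p :=
      ((H.source.differentiableAt hp).hasFDerivAt.clm_apply (hasFDerivAt_const b p)).clm_apply
        (hasFDerivAt_const c p)
    rw [h2.fderiv_eq, h3.fderiv, H.covDerivAlong_fderiv_apply hp (differentiableAt_const b),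
      H.covDerivAlong_fderiv_apply hp (differentiableAt_const c)] at h1
    simp [H.source.fderiv_eq hp, H.isometry p hp] at h1
    rw [H.target.symm _ (H.mapsTo hp) _ (fderiv ℝ f p b)]
    linarith
  have sy := H.localSecondForm_symm hp
  linarith [anti u v w, anti w u v, anti v w u, congrArg (h (f p) · (fderiv ℝ f p w)) (sy u v),
    congrArg (h (f p) · (fderiv ℝ f p u)) (sy v w), congrArg (h (f p) · (fderiv ℝ f p v)) (sy w u)]

lemma contDiffAt_localTension {ι : Type*} [Fintype ι] (b : Basis ι ℝ E)
    (H : IsLocalIsometricImmersion g Ω h Ω' f) (hp : p ∈ Ω) :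
    ContDiffAt ℝ ∞ (localTension b g (christoffel h) f) p := by
  refine ContDiffAt.sum fun i _ ↦ ?_
  have hf := H.contDiffAt_fderiv hp
  have hff : ContDiffAt ℝ ∞ (fderiv ℝ (fderiv ℝ f)) p := hf.fderiv_right (by simp)
  have hc := (H.source.contDiffAt_inverse hp).clm_apply
    (contDiffAt_const (c := LinearMap.toContinuousLinearMap (b.coord i)))
  exact (((hff.clm_apply contDiffAt_const).clm_apply hc).add
    (((H.contDiffAt_christoffel_comp hp).clm_apply (hf.clm_apply contDiffAt_const)).clm_apply
      (hf.clm_apply hc))).sub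
    (hf.clm_apply (((H.source.contDiffAt_christoffel hp).clm_apply contDiffAt_const).clm_apply hc))

end IsLocalIsometricImmersion

end LocalImmersion

/-! ### Normal fields with tangential derivative, and the Ricci identity -/

noncomputable section LocalBiharmonic

set_option maxSynthPendingDepth 3

attribute [-instance]
  instNormedAddCommGroupOfRiemannianBundleOfIsTopologicalAddGroupOfContinuousConstSMulReal
  instInnerProductSpaceReal

open ContinuousLinearMap

variable {E : Type*} [NormedAddCommGroup E] [NormedSpace ℝ E]
  {E' : Type*} [NormedAddCommGroup E'] [NormedSpace ℝ E']

/-- The tangential part of the covariant derivative of a field `V` along `f`, as the endomorphism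
`S` with `g(S u, w) = h(∇̄_u V, df(w))`. For normal `V`, it is minus the shape operator of `V`. -/
def tangentialDeriv (g : E → E →L[ℝ] E →L[ℝ] ℝ) (h : E' → E' →L[ℝ] E' →L[ℝ] ℝ) (f V : E → E')
    (p : E) : E →L[ℝ] E :=
  (g p).inverse ∘L (((h (f p) ∘L covDerivAlong (christoffel h) f V p).flip) ∘L fderiv ℝ f p).flip

/-- The covariant derivative `∂_v S + [Γ(v), S]` of a field `S` of endomorphisms. -/
def covDerivEnd (Γ : E → E →L[ℝ] E →L[ℝ] E) (S : E → E →L[ℝ] E) (p v : E) : E →L[ℝ] E :=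
  fderiv ℝ S p v + (Γ p v ∘L S p - S p ∘L Γ p v)

/-- The second covariant derivative `∇̄_v ∇̄_w V - ∇̄_{∇_v w} V` of `V` along `f`, for the vector
field on `E` with constant value `w`. -/
def localSecondCovDeriv (Γ : E → E →L[ℝ] E →L[ℝ] E) (Γ' : E' → E' →L[ℝ] E' →L[ℝ] E')
    (f V : E → E') (p v w : E) : E' :=
  covDerivAlong Γ' f (fun q ↦ covDerivAlong Γ' f V q w) p v - covDerivAlong Γ' f V p (Γ p v w)

/-- `localSecondForm` as a bilinear map. -/
def localSecondFormₗ (Γ : E → E →L[ℝ] E →L[ℝ] E) (Γ' : E' → E' →L[ℝ] E' →L[ℝ] E')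
    (f : E → E') (p : E) : E →ₗ[ℝ] E →ₗ[ℝ] E' :=
  LinearMap.mk₂ ℝ (localSecondForm Γ Γ' f p)
    (by intros; simp [localSecondForm]; abel)
    (by intros; simp [localSecondForm, smul_add, smul_sub])
    (by intros; simp [localSecondForm]; abel)
    (by intros; simp [localSecondForm, smul_add, smul_sub])

lemma localSecondForm_sum_smul {ι : Type*} [Fintype ι] (Γ : E → E →L[ℝ] E →L[ℝ] E)
    (Γ' : E' → E' →L[ℝ] E' →L[ℝ] E') (f : E → E') (p u : E) (c : ι → ℝ) (e : ι → E) :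
    localSecondForm Γ Γ' f p u (∑ i, c i • e i) = ∑ i, c i • localSecondForm Γ Γ' f p u (e i) := by
  change localSecondFormₗ Γ Γ' f p u _ = ∑ i, c i • localSecondFormₗ Γ Γ' f p u (e i)
  simp only [map_sum, map_smul]

lemma covDerivEnd_apply (Γ : E → E →L[ℝ] E →L[ℝ] E) (S : E → E →L[ℝ] E) (p v w : E) :
    covDerivEnd Γ S p v w = fderiv ℝ S p v w + (Γ p v (S p w) - S p (Γ p v w)) := by
  simp [covDerivEnd]

namespace IsLocalMetric

variable {g : E → E →L[ℝ] E →L[ℝ] ℝ} {Ω : Set E} {p : E} {ι κ : Type*} [Fintype ι] [Fintype κ]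
  [DecidableEq κ]

lemma sum_orthonormal (hg : IsLocalMetric g Ω) (hp : p ∈ Ω) (e : Basis κ ℝ E)
    (he : ∀ i j, g p (e i) (e j) = if i = j then 1 else 0) (u : E) :
    ∑ i, g p u (e i) • e i = u := by
  refine hg.ext hp fun w ↦ ?_
  obtain ⟨c, rfl⟩ : ∃ c : κ → ℝ, ∑ j, c j • e j = w := ⟨e.repr w, e.sum_repr w⟩
  simp [he, mul_comm]

/-- The metric trace of a bilinear map, in an arbitrary basis and in an orthonormal one. -/
lemma sum_inverse_coord [FiniteDimensional ℝ E] (hg : IsLocalMetric g Ω) (hp : p ∈ Ω)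
    (b : Basis ι ℝ E) (e : Basis κ ℝ E) (he : ∀ i j, g p (e i) (e j) = if i = j then 1 else 0)
    (B : E →ₗ[ℝ] E →ₗ[ℝ] E') :
    ∑ i, B (b i) ((g p).inverse (LinearMap.toContinuousLinearMap (b.coord i))) =
      ∑ i, B (e i) (e i) := by
  have hinv : ∀ i, (g p).inverse (LinearMap.toContinuousLinearMap (b.coord i)) =
      ∑ j, b.coord i (e j) • e j := fun i ↦ by
    rw [← hg.sum_orthonormal hp e he ((g p).inverse _)]
    simp only [hg.apply_inverse hp, LinearMap.coe_toContinuousLinearMap']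
  simp only [hinv, map_sum, map_smul]
  rw [Finset.sum_comm]
  refine Finset.sum_congr rfl fun j _ ↦ ?_
  have hj : ∑ i, b.coord i (e j) • b i = e j := b.sum_repr (e j)
  conv_rhs => arg 1; rw [← hj]
  simp only [map_sum, map_smul, LinearMap.sum_apply, LinearMap.smul_apply]

lemma sum_orthonormal_eq [FiniteDimensional ℝ E] [DecidableEq ι] (hg : IsLocalMetric g Ω)
    (hp : p ∈ Ω) (e : Basis κ ℝ E) (he : ∀ i j, g p (e i) (e j) = if i = j then 1 else 0)
    (e' : Basis ι ℝ E) (he' : ∀ i j, g p (e' i) (e' j) = if i = j then 1 else 0)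
    (B : E →ₗ[ℝ] E →ₗ[ℝ] E') : ∑ i, B (e i) (e i) = ∑ i, B (e' i) (e' i) := by
  rw [← hg.sum_inverse_coord hp e e he, hg.sum_inverse_coord hp e e' he']

end IsLocalMetric

namespace IsLocalIsometricImmersion

variable {g : E → E →L[ℝ] E →L[ℝ] ℝ} {Ω : Set E} {h : E' → E' →L[ℝ] E' →L[ℝ] ℝ}
  {Ω' : Set E'} {f V : E → E'} {p : E} [FiniteDimensional ℝ E] [FiniteDimensional ℝ E']

omit [FiniteDimensional ℝ E'] in
lemma apply_tangentialDeriv (H : IsLocalIsometricImmersion g Ω h Ω' f) (hp : p ∈ Ω) (u w : E) :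
    g p (tangentialDeriv g h f V p u) w =
      h (f p) (covDerivAlong (christoffel h) f V p u) (fderiv ℝ f p w) := by
  simp [tangentialDeriv, H.source.apply_inverse hp]

lemma contDiffAt_tangentialDeriv (H : IsLocalIsometricImmersion g Ω h Ω' f) (hp : p ∈ Ω)
    (hV : ContDiffAt ℝ ∞ V p) : ContDiffAt ℝ ∞ (tangentialDeriv g h f V) p := by
  have hh : ContDiffAt ℝ ∞ (fun q ↦ h (f q)) p :=
    (H.target.contDiffAt _ (H.mapsTo hp)).comp p (H.contDiffAt p hp)
  have h1 : ContDiffAt ℝ ∞ (fun q ↦ h (f q) ∘L covDerivAlong (christoffel h) f V q) p :=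
    hh.clm_comp (H.contDiffAt_covDerivAlong hp hV)
  have h2 : ContDiffAt ℝ ∞
      (fun q ↦ (h (f q) ∘L covDerivAlong (christoffel h) f V q).flip ∘L fderiv ℝ f q) p :=
    ((flipₗᵢ ℝ E E' ℝ).contDiff.contDiffAt.comp p h1).clm_comp (H.contDiffAt_fderiv hp)
  exact (H.source.contDiffAt_inverse hp).clm_comp
    ((flipₗᵢ ℝ E E ℝ).contDiff.contDiffAt.comp p h2)

omit [FiniteDimensional ℝ E'] in
lemma fderiv_tangentialDeriv (H : IsLocalIsometricImmersion g Ω h Ω' f) (hp : p ∈ Ω) {u : E}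
    (hu : ∃ a, covDerivAlong (christoffel h) f V p u = fderiv ℝ f p a) :
    fderiv ℝ f p (tangentialDeriv g h f V p u) = covDerivAlong (christoffel h) f V p u := by
  obtain ⟨a, ha⟩ := hu
  have : tangentialDeriv g h f V p u = a := H.source.ext hp fun w ↦ by
    rw [H.apply_tangentialDeriv hp, ha, H.isometry p hp]
  rw [this, ha]

/-- The Weingarten equation `⟨∇̄_u V, df(w)⟩ = -⟨V, B(u, w)⟩` for a normal field `V`. -/
lemma apply_tangentialDeriv_of_normal (H : IsLocalIsometricImmersion g Ω h Ω' f) (hp : p ∈ Ω)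
    (hV : DifferentiableAt ℝ V p) (hn : ∀ q ∈ Ω, ∀ w, h (f q) (V q) (fderiv ℝ f q w) = 0)
    (u w : E) :
    g p (tangentialDeriv g h f V p u) w =
      -h (f p) (V p) (localSecondForm (christoffel g) (christoffel h) f p u w) := by
  have hd : DifferentiableAt ℝ (fun q ↦ fderiv ℝ f q w) p :=
    ((H.contDiffAt_fderiv hp).clm_apply contDiffAt_const).differentiableAt (by simp)
  have h1 := H.fderiv_inner hp hV hd u
  have h2 : (fun q ↦ h (f q) (V q) (fderiv ℝ f q w)) =ᶠ[nhds p] fun _ ↦ 0 :=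
    Filter.eventually_of_mem (H.source.mem_nhds hp) fun q hq ↦ hn q hq w
  rw [h2.fderiv_eq, H.covDerivAlong_fderiv_apply hp (differentiableAt_const w), map_add,
    hn p hp] at h1
  rw [H.apply_tangentialDeriv hp]
  simp at h1
  linarith

/-- If the derivative of `V` is tangential, `∇̄_u V = df(S u)`, then
`∇̄²_{v, w} V = B(v, S w) + df((∇_v S) w)`. -/
lemma localSecondCovDeriv_eq (H : IsLocalIsometricImmersion g Ω h Ω' f) (hp : p ∈ Ω)
    (hV : ContDiffAt ℝ ∞ V p)
    (ht : ∀ q ∈ Ω, ∀ u, ∃ a, covDerivAlong (christoffel h) f V q u = fderiv ℝ f q a) (v w : E) :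
    localSecondCovDeriv (christoffel g) (christoffel h) f V p v w =
      localSecondForm (christoffel g) (christoffel h) f p v (tangentialDeriv g h f V p w)
        + fderiv ℝ f p (covDerivEnd (christoffel g) (tangentialDeriv g h f V) p v w) := by
  have hS := ((H.contDiffAt_tangentialDeriv hp hV).differentiableAt (by simp)).hasFDerivAt
  have hSw : HasFDerivAt (fun q ↦ tangentialDeriv g h f V q w) _ p :=
    hS.clm_apply (hasFDerivAt_const w p)
  have h1 : (fun q ↦ covDerivAlong (christoffel h) f V q w) =ᶠ[nhds p]
      fun q ↦ fderiv ℝ f q (tangentialDeriv g h f V q w) :=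
    Filter.eventually_of_mem (H.source.mem_nhds hp) fun q hq ↦
      (H.fderiv_tangentialDeriv hq (ht q hq w)).symm
  have h2 : covDerivAlong (christoffel h) f (fun q ↦ covDerivAlong (christoffel h) f V q w) p v =
      covDerivAlong (christoffel h) f
        (fun q ↦ fderiv ℝ f q (tangentialDeriv g h f V q w)) p v := by
    rw [covDerivAlong_apply _ f fun q ↦ covDerivAlong (christoffel h) f V q w,
      covDerivAlong_apply _ f fun q ↦ fderiv ℝ f q _, h1.fderiv_eq]
    exact congrArg (fun x ↦ _ + christoffel h (f p) (fderiv ℝ f p v) x) h1.self_of_nhds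
  rw [localSecondCovDeriv, h2, H.covDerivAlong_fderiv_apply hp hSw.differentiableAt,
    ← H.fderiv_tangentialDeriv hp (ht p hp _), hSw.fderiv, covDerivEnd_apply]
  simp
  abel

omit [FiniteDimensional ℝ E'] in
/-- The covariant derivative of a field of self-adjoint endomorphisms is self-adjoint. -/
lemma covDerivEnd_symm (H : IsLocalIsometricImmersion g Ω h Ω' f) (hp : p ∈ Ω)
    {S : E → E →L[ℝ] E} (hS : DifferentiableAt ℝ S p)
    (hsymm : ∀ q ∈ Ω, ∀ u w, g q (S q u) w = g q (S q w) u) (v w z : E) :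
    g p (covDerivEnd (christoffel g) S p v w) z = g p (covDerivEnd (christoffel g) S p v z) w := by
  have key : ∀ a b, HasFDerivAt (fun q ↦ g q (S q a) b) _ p := fun a b ↦
    ((H.source.differentiableAt hp).hasFDerivAt.clm_apply
      (hS.hasFDerivAt.clm_apply (hasFDerivAt_const a p))).clm_apply (hasFDerivAt_const b p)
  have h3 : (fun q ↦ g q (S q w) z) =ᶠ[nhds p] fun q ↦ g q (S q z) w :=
    Filter.eventually_of_mem (H.source.mem_nhds hp) fun q hq ↦ hsymm q hq w z
  have h1 := DFunLike.congr_fun (((key w z)).unique ((key z w).congr_of_eventuallyEq h3)) v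
  simp [H.source.fderiv_eq hp] at h1
  have h4 := hsymm p hp (christoffel g p v z) w
  have h5 := hsymm p hp (christoffel g p v w) z
  simp only [covDerivEnd_apply, map_add, map_sub, add_apply, sub_apply]
  linarith

omit [FiniteDimensional ℝ E'] in
/-- The tension field is `∑ B(eᵢ, eᵢ)` for any orthonormal basis `(eᵢ)`. -/
lemma localTension_eq_sum (H : IsLocalIsometricImmersion g Ω h Ω' f) (hp : p ∈ Ω) {ι κ : Type*}
    [Fintype ι] [Fintype κ] [DecidableEq κ] (b : Basis ι ℝ E) (e : Basis κ ℝ E)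
    (he : ∀ i j, g p (e i) (e j) = if i = j then 1 else 0) :
    localTension b g (christoffel h) f p =
      ∑ i, localSecondForm (christoffel g) (christoffel h) f p (e i) (e i) :=
  H.source.sum_inverse_coord hp b e he (localSecondFormₗ (christoffel g) (christoffel h) f p)

/-- The tension field is normal. -/
lemma inner_localTension_fderiv (H : IsLocalIsometricImmersion g Ω h Ω' f) (hp : p ∈ Ω)
    {ι : Type*} [Fintype ι] (b : Basis ι ℝ E) (w : E) :
    h (f p) (localTension b g (christoffel h) f p) (fderiv ℝ f p w) = 0 := by
  simp [localTension, H.inner_localSecondForm_fderiv hp]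

omit [FiniteDimensional ℝ E'] in
lemma sum_riemann_eq (H : IsLocalIsometricImmersion g Ω h Ω' f) (hp : p ∈ Ω) {ι κ : Type*}
    [Fintype ι] [Fintype κ] [DecidableEq ι] [DecidableEq κ] (e : Basis κ ℝ E)
    (he : ∀ i j, g p (e i) (e j) = if i = j then 1 else 0) (e' : Basis ι ℝ E)
    (he' : ∀ i j, g p (e' i) (e' j) = if i = j then 1 else 0) (u : E') :
    ∑ i, riemann (christoffel h) (f p) u (fderiv ℝ f p (e i)) (fderiv ℝ f p (e i)) =
      ∑ i, riemann (christoffel h) (f p) u (fderiv ℝ f p (e' i)) (fderiv ℝ f p (e' i)) :=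
  H.source.sum_orthonormal_eq hp e he e' he' <| LinearMap.mk₂ ℝ
    (fun v w ↦ riemann (christoffel h) (f p) u (fderiv ℝ f p v) (fderiv ℝ f p w))
    (by intros; simp [riemann]; abel)
    (by intros; simp [riemann, smul_add, smul_sub])
    (by intros; simp [riemann]; abel)
    (by intros; simp [riemann, smul_add, smul_sub])

lemma sum_localSecondCovDeriv_eq (H : IsLocalIsometricImmersion g Ω h Ω' f) (hp : p ∈ Ω)
    {ι κ : Type*} [Fintype ι] [Fintype κ] [DecidableEq ι] [DecidableEq κ] (e : Basis κ ℝ E)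
    (he : ∀ i j, g p (e i) (e j) = if i = j then 1 else 0) (e' : Basis ι ℝ E)
    (he' : ∀ i j, g p (e' i) (e' j) = if i = j then 1 else 0) (hV : ContDiffAt ℝ ∞ V p)
    (ht : ∀ q ∈ Ω, ∀ u, ∃ a, covDerivAlong (christoffel h) f V q u = fderiv ℝ f q a) :
    ∑ i, localSecondCovDeriv (christoffel g) (christoffel h) f V p (e i) (e i) =
      ∑ i, localSecondCovDeriv (christoffel g) (christoffel h) f V p (e' i) (e' i) := by
  simp only [H.localSecondCovDeriv_eq hp hV ht, covDerivEnd_apply]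
  exact H.source.sum_orthonormal_eq hp e he e' he' <| LinearMap.mk₂ ℝ
    (fun v w ↦ localSecondForm (christoffel g) (christoffel h) f p v (tangentialDeriv g h f V p w)
      + fderiv ℝ f p (fderiv ℝ (tangentialDeriv g h f V) p v w
        + (christoffel g p v (tangentialDeriv g h f V p w)
          - tangentialDeriv g h f V p (christoffel g p v w))))
    (by intros; simp [localSecondForm]; abel)
    (by intros; simp [localSecondForm, smul_add, smul_sub])
    (by intros; simp [localSecondForm]; abel)
    (by intros; simp [localSecondForm, smul_add, smul_sub])

section ParallelTension

variable {ι κ : Type*} [Fintype ι] [Fintype κ] (b : Basis ι ℝ E)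

/-- The shape operator `-S` of the tension field has trace `|τ|²`, and if `τ` is parallel in the
normal bundle, then `|τ|²` has derivative `2⟨∇̄τ, τ⟩ = 0`. Hence `∇S` is trace-free. -/
lemma trace_covDerivEnd_tension (H : IsLocalIsometricImmersion g Ω h Ω' f) (hp : p ∈ Ω)
    (ht : ∀ q ∈ Ω, ∀ u, ∃ a,
      covDerivAlong (christoffel h) f (localTension b g (christoffel h) f) q u = fderiv ℝ f q a)
    (v : E) :
    LinearMap.trace ℝ E (covDerivEnd (christoffel g)
      (tangentialDeriv g h f (localTension b g (christoffel h) f)) p v : E →ₗ[ℝ] E) = 0 := by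
  set τ := localTension b g (christoffel h) f with hτ
  set S := tangentialDeriv g h f τ with hS
  have hτd : ∀ q ∈ Ω, DifferentiableAt ℝ τ q := fun q hq ↦
    (H.contDiffAt_localTension b hq).differentiableAt (by simp)
  have hSd := ((H.contDiffAt_tangentialDeriv hp
    (H.contDiffAt_localTension b hp)).differentiableAt (by simp)).hasFDerivAt
  have hn : ∀ q ∈ Ω, ∀ w, h (f q) (τ q) (fderiv ℝ f q w) = 0 := fun q hq w ↦
    H.inner_localTension_fderiv hq b w
  have htr : ∀ q ∈ Ω, ∑ i, LinearMap.toContinuousLinearMap (b.coord i) (S q (b i)) =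
      -h (f q) (τ q) (τ q) := by
    intro q hq
    conv_rhs => rw [hτ]; arg 1; arg 2; rw [localTension]
    rw [map_sum, ← Finset.sum_neg_distrib]
    refine Finset.sum_congr rfl fun i _ ↦ ?_
    rw [← H.apply_tangentialDeriv_of_normal hq (hτd q hq) hn, H.source.symm q hq,
      H.source.apply_inverse hq]
  have h1 : HasFDerivAt
      (fun q ↦ ∑ i, LinearMap.toContinuousLinearMap (b.coord i) (S q (b i))) _ p :=
    HasFDerivAt.fun_sum fun i _ ↦
      ((LinearMap.toContinuousLinearMap (b.coord i)).hasFDerivAt.comp p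
        (hSd.clm_apply (hasFDerivAt_const (b i) p)))
  have h2 : (fun q ↦ ∑ i, LinearMap.toContinuousLinearMap (b.coord i) (S q (b i))) =ᶠ[nhds p]
      fun q ↦ -h (f q) (τ q) (τ q) :=
    Filter.eventually_of_mem (H.source.mem_nhds hp) htr
  have h3 : fderiv ℝ (fun q ↦ -h (f q) (τ q) (τ q)) p v = 0 := by
    rw [fderiv_fun_neg, neg_apply, H.fderiv_inner hp (hτd p hp) (hτd p hp)]
    obtain ⟨a, ha⟩ := ht p hp v
    rw [ha, hn p hp, H.target.symm _ (H.mapsTo hp), hn p hp]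
    simp
  have h4 : ∑ i, b.coord i (fderiv ℝ S p v (b i)) = 0 := by
    rw [← h2.fderiv_eq, h1.fderiv] at h3
    simpa using h3
  have h5 : LinearMap.trace ℝ E (fderiv ℝ S p v : E →ₗ[ℝ] E) = 0 := by
    rw [← sum_coord_eq_trace b]; exact h4
  have h6 := LinearMap.trace_mul_comm ℝ (christoffel g p v : E →ₗ[ℝ] E) (S p : E →ₗ[ℝ] E)
  have h7 : (covDerivEnd (christoffel g) S p v : E →ₗ[ℝ] E) = (fderiv ℝ S p v : E →ₗ[ℝ] E)
      + ((christoffel g p v : E →ₗ[ℝ] E) * (S p : E →ₗ[ℝ] E)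
        - (S p : E →ₗ[ℝ] E) * (christoffel g p v : E →ₗ[ℝ] E)) := by
    ext w; simp [covDerivEnd_apply]
  rw [h7, map_add, map_sub, h5, h6]
  simp

variable [DecidableEq κ] (e : Basis κ ℝ E)

/-- The tangential part of the trace of `∇̄²τ` is that of the curvature term: by the Ricci identity,
`∑ ⟨∇̄²τ(eᵢ, eᵢ), df(z)⟩ = ∑ ⟨∇̄²τ(z, eᵢ), df(eᵢ)⟩ + ∑ ⟨R(df(eᵢ), df(z))τ, df(eᵢ)⟩`, and the
first sum on the right is the trace of `∇_z S`. -/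
lemma inner_sum_localSecondCovDeriv (H : IsLocalIsometricImmersion g Ω h Ω' f) (hp : p ∈ Ω)
    (ht : ∀ q ∈ Ω, ∀ u, ∃ a,
      covDerivAlong (christoffel h) f (localTension b g (christoffel h) f) q u = fderiv ℝ f q a)
    (he : ∀ i j, g p (e i) (e j) = if i = j then 1 else 0) (z : E) :
    h (f p) (∑ i, localSecondCovDeriv (christoffel g) (christoffel h) f
        (localTension b g (christoffel h) f) p (e i) (e i)) (fderiv ℝ f p z) =
      h (f p) (∑ i, riemann (christoffel h) (f p) (localTension b g (christoffel h) f p)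
        (fderiv ℝ f p (e i)) (fderiv ℝ f p (e i))) (fderiv ℝ f p z) := by
  set τ := localTension b g (christoffel h) f with hτ
  set S := tangentialDeriv g h f τ with hS
  have hτd : ∀ q ∈ Ω, ContDiffAt ℝ ∞ τ q := fun q hq ↦ H.contDiffAt_localTension b hq
  have hn : ∀ q ∈ Ω, ∀ w, h (f q) (τ q) (fderiv ℝ f q w) = 0 := fun q hq w ↦
    H.inner_localTension_fderiv hq b w
  have hSd := (H.contDiffAt_tangentialDeriv hp (hτd p hp)).differentiableAt (by simp)
  have hsymm : ∀ q ∈ Ω, ∀ u w, g q (S q u) w = g q (S q w) u := fun q hq u w ↦ by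
    rw [H.apply_tangentialDeriv_of_normal hq ((hτd q hq).differentiableAt (by simp)) hn,
      H.apply_tangentialDeriv_of_normal hq ((hτd q hq).differentiableAt (by simp)) hn,
      H.localSecondForm_symm hq]
  have hinner : ∀ v w x,
      h (f p) (localSecondCovDeriv (christoffel g) (christoffel h) f τ p v w) (fderiv ℝ f p x) =
        g p (covDerivEnd (christoffel g) S p v w) x := fun v w x ↦ by
    rw [H.localSecondCovDeriv_eq hp (hτd p hp) ht, map_add, add_apply,
      H.inner_localSecondForm_fderiv hp, H.isometry p hp, zero_add]
  have hRicci : ∀ v w, localSecondCovDeriv (christoffel g) (christoffel h) f τ p v w =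
      localSecondCovDeriv (christoffel g) (christoffel h) f τ p w v
        + riemann (christoffel h) (f p) (fderiv ℝ f p v) (fderiv ℝ f p w) (τ p) := fun v w ↦ by
    rw [← covDerivAlong_comm H.target (H.mapsTo hp) (H.contDiffAt p hp) (hτd p hp),
      localSecondCovDeriv, localSecondCovDeriv, H.source.christoffel_symm hp v w]
    abel
  have htrace : ∑ i, g p (covDerivEnd (christoffel g) S p z (e i)) (e i) = 0 := by
    have h1 := H.trace_covDerivEnd_tension b hp ht z
    rw [← sum_coord_eq_trace e] at h1
    rw [← h1]
    refine Finset.sum_congr rfl fun i _ ↦ ?_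
    conv_rhs => rw [ContinuousLinearMap.coe_coe, ← H.source.sum_orthonormal hp e he
      (covDerivEnd (christoffel g) S p z (e i))]
    simp [Finsupp.single_apply]
  simp only [map_sum, sum_apply]
  have hterm : ∀ i,
      h (f p) (localSecondCovDeriv (christoffel g) (christoffel h) f τ p (e i) (e i))
        (fderiv ℝ f p z) = g p (covDerivEnd (christoffel g) S p z (e i)) (e i)
      + h (f p) (riemann (christoffel h) (f p) (τ p) (fderiv ℝ f p (e i)) (fderiv ℝ f p (e i)))
        (fderiv ℝ f p z) := fun i ↦ by
    rw [hinner, H.covDerivEnd_symm hp hSd hsymm, ← hinner, hRicci, map_add, add_apply, hinner,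
      H.target.riemann_pair_symm (H.mapsTo hp) (τ p)]
  simp only [hterm, Finset.sum_add_distrib, htrace, zero_add]

/-- The tangential and normal parts of the biharmonic equation of an isometric immersion whose
tension field is parallel in the normal bundle, at a point of a chart. -/
theorem neg_sum_localSecondCovDeriv_eq_iff (H : IsLocalIsometricImmersion g Ω h Ω' f) (hp : p ∈ Ω)
    (ht : ∀ q ∈ Ω, ∀ u, ∃ a,
      covDerivAlong (christoffel h) f (localTension b g (christoffel h) f) q u = fderiv ℝ f q a)
    (he : ∀ i j, g p (e i) (e j) = if i = j then 1 else 0) :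
    -∑ i, localSecondCovDeriv (christoffel g) (christoffel h) f
        (localTension b g (christoffel h) f) p (e i) (e i) =
      ∑ i, riemann (christoffel h) (f p) (localTension b g (christoffel h) f p)
        (fderiv ℝ f p (e i)) (fderiv ℝ f p (e i)) ↔
    ∑ i, riemann (christoffel h) (f p) (localTension b g (christoffel h) f p)
        (fderiv ℝ f p (e i)) (fderiv ℝ f p (e i)) =
      ∑ i, ∑ j, h (f p) (localTension b g (christoffel h) f p)
          (localSecondForm (christoffel g) (christoffel h) f p (e i) (e j)) •
        localSecondForm (christoffel g) (christoffel h) f p (e i) (e j) := by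
  have htan := H.inner_sum_localSecondCovDeriv b e hp ht he
  set τ := localTension b g (christoffel h) f with hτ
  set S := tangentialDeriv g h f τ with hS
  set R := ∑ i, riemann (christoffel h) (f p) (τ p) (fderiv ℝ f p (e i)) (fderiv ℝ f p (e i))
  set Q := ∑ i, ∑ j, h (f p) (τ p)
      (localSecondForm (christoffel g) (christoffel h) f p (e i) (e j)) •
    localSecondForm (christoffel g) (christoffel h) f p (e i) (e j) with hQ
  have hτd : ContDiffAt ℝ ∞ τ p := H.contDiffAt_localTension b hp
  have hn : ∀ q ∈ Ω, ∀ w, h (f q) (τ q) (fderiv ℝ f q w) = 0 := fun q hq w ↦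
    H.inner_localTension_fderiv hq b w
  have hQn : ∀ z, h (f p) Q (fderiv ℝ f p z) = 0 := fun z ↦ by
    simp [hQ, H.inner_localSecondForm_fderiv hp]
  -- The trace of `∇̄²τ` is `-Q` plus a tangential vector.
  have hL : ∑ i, localSecondCovDeriv (christoffel g) (christoffel h) f τ p (e i) (e i) =
      -Q + fderiv ℝ f p (∑ i, covDerivEnd (christoffel g) S p (e i) (e i)) := by
    simp only [H.localSecondCovDeriv_eq hp hτd ht, Finset.sum_add_distrib, map_sum]
    congr 1
    rw [hQ, ← Finset.sum_neg_distrib]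
    refine Finset.sum_congr rfl fun i _ ↦ ?_
    conv_lhs => rw [← H.source.sum_orthonormal hp e he (tangentialDeriv g h f τ p (e i))]
    rw [localSecondForm_sum_smul, ← Finset.sum_neg_distrib]
    simp only [H.apply_tangentialDeriv_of_normal hp (hτd.differentiableAt (by simp)) hn, neg_smul]
  rw [hL] at htan ⊢
  set T := ∑ i, covDerivEnd (christoffel g) S p (e i) (e i)
  -- `df(T)` is the tangential part of `R`, and either equation forces it to vanish.
  have hT : ∀ z, g p T z = h (f p) R (fderiv ℝ f p z) := fun z ↦ by
    rw [← htan z, map_add, add_apply, H.isometry p hp, map_neg, neg_apply, hQn]; simp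
  have hT0 : (∀ z, h (f p) R (fderiv ℝ f p z) = 0) → T = 0 := fun h0 ↦
    H.source.ext hp fun z ↦ by rw [hT, h0]; simp
  constructor
  · intro hR
    have : T = 0 := hT0 fun z ↦ by
      have h1 := hT z
      rw [← hR] at h1 ⊢
      simp only [neg_add_rev, neg_neg, map_add, map_neg, add_apply, neg_apply, H.isometry p hp,
        hQn] at h1 ⊢
      linarith
    rw [← hR, this]; simp
  · intro hR
    have : T = 0 := hT0 fun z ↦ by rw [hR, hQn]
    rw [this, hR]; simp

end ParallelTension

end IsLocalIsometricImmersion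

end LocalBiharmonic

/-! ### Tangent vectors, derivatives and Lie brackets in a chart -/

noncomputable section Charts

set_option maxSynthPendingDepth 3

variable {E : Type*} [NormedAddCommGroup E] [NormedSpace ℝ E]
  {H : Type*} [TopologicalSpace H] (I : ModelWithCorners ℝ E H)
  {M : Type*} [TopologicalSpace M] [ChartedSpace H M] [IsManifold I ∞ M]

/-- The coordinates, in the chart at `x₀`, of a tangent vector at `x`. -/
def toCoord (x₀ x : M) : TangentSpace I x →L[ℝ] E :=
  (trivializationAt E (fun z : M ↦ TangentSpace I z) x₀).continuousLinearMapAt ℝ x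

/-- The tangent vector at `x` with given coordinates in the chart at `x₀`. -/
def ofCoord (x₀ x : M) : E →L[ℝ] TangentSpace I x :=
  (trivializationAt E (fun z : M ↦ TangentSpace I z) x₀).symmL ℝ x

/-- The expression in the chart at `x₀` of the vector field `Y`. -/
def coordField (x₀ : M) (Y : Π x : M, TangentSpace I x) (p : E) : E :=
  toCoord I x₀ ((extChartAt I x₀).symm p) (Y ((extChartAt I x₀).symm p))

variable {I} {x₀ x : M}

lemma mem_baseSet_of_mem_source (hx : x ∈ (extChartAt I x₀).source) :
    x ∈ (trivializationAt E (fun z : M ↦ TangentSpace I z) x₀).baseSet := by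
  simpa using hx

lemma ofCoord_toCoord (hx : x ∈ (extChartAt I x₀).source) (v : TangentSpace I x) :
    ofCoord I x₀ x (toCoord I x₀ x v) = v :=
  (trivializationAt E (fun z : M ↦ TangentSpace I z) x₀).symmL_continuousLinearMapAt
    (mem_baseSet_of_mem_source hx) v

lemma toCoord_ofCoord (hx : x ∈ (extChartAt I x₀).source) (v : E) :
    toCoord I x₀ x (ofCoord I x₀ x v) = v :=
  (trivializationAt E (fun z : M ↦ TangentSpace I z) x₀).continuousLinearMapAt_symmL
    (mem_baseSet_of_mem_source hx) v

lemma toCoord_injective (hx : x ∈ (extChartAt I x₀).source) :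
    Function.Injective (toCoord I x₀ x) :=
  Function.LeftInverse.injective (ofCoord_toCoord hx)

lemma toCoord_apply (hx : x ∈ (extChartAt I x₀).source) (v : TangentSpace I x) :
    toCoord I x₀ x v = (trivializationAt E (fun z : M ↦ TangentSpace I z) x₀
      (TotalSpace.mk' E x v)).2 :=
  congrFun ((trivializationAt E (fun z : M ↦ TangentSpace I z)
    x₀).coe_linearMapAt_of_mem (R := ℝ) (mem_baseSet_of_mem_source hx)) v

lemma ofCoord_apply (hx : x ∈ (extChartAt I x₀).source) (v : E) :
    ofCoord I x₀ x v = (trivializationAt E (fun z : M ↦ TangentSpace I z) x₀).symm x v :=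
  (trivializationAt E (fun z : M ↦ TangentSpace I z) x₀).symmL_apply (R := ℝ)
    (mem_baseSet_of_mem_source hx) v

lemma toCoord_eq_mfderiv (hx : x ∈ (extChartAt I x₀).source) :
    toCoord I x₀ x = mfderiv I 𝓘(ℝ, E) (extChartAt I x₀) x :=
  TangentBundle.continuousLinearMapAt_trivializationAt (by simpa using hx)

lemma ofCoord_eq_mfderiv [I.Boundaryless] (hx : x ∈ (extChartAt I x₀).source) :
    ofCoord I x₀ x = mfderiv 𝓘(ℝ, E) I (extChartAt I x₀).symm (extChartAt I x₀ x) := by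
  have := TangentBundle.symmL_trivializationAt (I := I) (x₀ := x₀) (x := x) (by simpa using hx)
  rw [I.range_eq_univ, mfderivWithin_univ] at this
  exact this

lemma coordField_extChartAt (Y : Π x : M, TangentSpace I x) (hx : x ∈ (extChartAt I x₀).source) :
    coordField I x₀ Y (extChartAt I x₀ x) = toCoord I x₀ x (Y x) := by
  rw [coordField, (extChartAt I x₀).left_inv hx]

lemma mvfderiv_eq_fderiv {G : Type*} [NormedAddCommGroup G] [NormedSpace ℝ G] {F : M → G}
    (hx : x ∈ (extChartAt I x₀).source)
    (hF : DifferentiableAt ℝ (fun p ↦ F ((extChartAt I x₀).symm p)) (extChartAt I x₀ x))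
    (v : TangentSpace I x) :
    mvfderiv I F x v =
      fderiv ℝ (fun p ↦ F ((extChartAt I x₀).symm p)) (extChartAt I x₀ x) (toCoord I x₀ x v) := by
  have h1 : F =ᶠ[nhds x] (fun p ↦ F ((extChartAt I x₀).symm p)) ∘ extChartAt I x₀ :=
    Filter.eventually_of_mem ((isOpen_extChartAt_source x₀).mem_nhds hx) fun z hz ↦ by
      rw [Function.comp, (extChartAt I x₀).left_inv hz]
  have h2 : MDifferentiableAt I 𝓘(ℝ, E) (extChartAt I x₀) x :=
    mdifferentiableAt_extChartAt (by simpa using hx)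
  rw [mvfderiv, h1.mfderiv_eq, mfderiv_comp x hF.mdifferentiableAt h2, toCoord_eq_mfderiv hx,
    mfderiv_eq_fderiv]
  rfl

lemma mdifferentiableAt_of_coordField {Y : Π x : M, TangentSpace I x}
    (hx : x ∈ (extChartAt I x₀).source)
    (hY : DifferentiableAt ℝ (coordField I x₀ Y) (extChartAt I x₀ x)) :
    MDifferentiableAt I I.tangent (fun z ↦ (TotalSpace.mk z (Y z) : TangentBundle I M)) x := by
  refine ((trivializationAt E (fun z : M ↦ TangentSpace I z)
    x₀).mdifferentiableAt_section_iff I Y (mem_baseSet_of_mem_source hx)).2 ?_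
  have h2 : MDifferentiableAt I 𝓘(ℝ, E) (extChartAt I x₀) x :=
    mdifferentiableAt_extChartAt (by simpa using hx)
  refine (hY.mdifferentiableAt.comp x h2).congr_of_eventuallyEq ?_
  refine Filter.eventually_of_mem ((isOpen_extChartAt_source x₀).mem_nhds hx) fun z hz ↦ ?_
  rw [Function.comp, coordField_extChartAt Y hz, toCoord_apply hz]

lemma toCoord_mlieBracket [I.Boundaryless] [CompleteSpace E] {X Y : Π x : M, TangentSpace I x}
    (hx : x ∈ (extChartAt I x₀).source)
    (hX : DifferentiableAt ℝ (coordField I x₀ X) (extChartAt I x₀ x))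
    (hY : DifferentiableAt ℝ (coordField I x₀ Y) (extChartAt I x₀ x)) :
    toCoord I x₀ x (VectorField.mlieBracket I X Y x) =
      fderiv ℝ (coordField I x₀ Y) (extChartAt I x₀ x) (toCoord I x₀ x (X x))
        - fderiv ℝ (coordField I x₀ X) (extChartAt I x₀ x) (toCoord I x₀ x (Y x)) := by
  have hp := (extChartAt I x₀).map_source hx
  have hli := (extChartAt I x₀).left_inv hx
  have hc : ContMDiffAt 𝓘(ℝ, E) I ∞ (extChartAt I x₀).symm (extChartAt I x₀ x) :=
    (contMDiffOn_extChartAt_symm x₀).contMDiffAt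
      ((isOpen_extChartAt_target x₀).mem_nhds hp)
  have h2 : minSmoothness ℝ 2 ≤ ∞ := by
    rw [minSmoothness_of_isRCLikeNormedField]; exact ENat.LEInfty.out
  have hpull : ∀ Z : Π x : M, TangentSpace I x, ∀ p ∈ (extChartAt I x₀).target,
      VectorField.mpullback 𝓘(ℝ, E) I (extChartAt I x₀).symm Z p = coordField I x₀ Z p := by
    intro Z p hp'
    have hs := (extChartAt I x₀).map_target hp'
    have h3 := ofCoord_eq_mfderiv hs
    have h4 : (ofCoord I x₀ ((extChartAt I x₀).symm p)).inverse =
        toCoord I x₀ ((extChartAt I x₀).symm p) :=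
      ContinuousLinearMap.inverse_eq (by ext v; exact ofCoord_toCoord hs v)
        (by ext v; exact toCoord_ofCoord hs v)
    rw [h3, (extChartAt I x₀).right_inv hp'] at h4
    exact DFunLike.congr_fun h4 (Z _)
  have : IsManifold I (minSmoothness ℝ 2) M := .of_le (n := ∞) h2
  have key := VectorField.mpullback_mlieBracket (I := 𝓘(ℝ, E)) (I' := I) (n := ∞) (V := X) (W := Y)
    (f := (extChartAt I x₀).symm) (x₀ := extChartAt I x₀ x)
    (by rw [hli]; exact mdifferentiableAt_of_coordField hx hX)
    (by rw [hli]; exact mdifferentiableAt_of_coordField hx hY) hc h2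
  rw [hpull _ _ hp, coordField_extChartAt _ hx] at key
  rw [key, ← VectorField.mlieBracketWithin_univ, VectorField.mlieBracketWithin_eq_lieBracketWithin]
  refine (congrFun (VectorField.lieBracketWithin_univ (𝕜 := ℝ)) _).trans ?_
  have hev : ∀ Z : Π x : M, TangentSpace I x,
      VectorField.mpullback 𝓘(ℝ, E) I (extChartAt I x₀).symm Z =ᶠ[nhds (extChartAt I x₀ x)]
        coordField I x₀ Z := fun Z ↦
    Filter.eventually_of_mem ((isOpen_extChartAt_target x₀).mem_nhds hp) (hpull Z)
  have := Filter.EventuallyEq.lieBracket_vectorField_eq (𝕜 := ℝ) (hev X) (hev Y)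
  refine this.trans ?_
  rw [VectorField.lieBracket, coordField_extChartAt X hx, coordField_extChartAt Y hx]

end Charts

/-! ### The metric and the Levi-Civita connection in a chart -/

noncomputable section RiemannianCharts

set_option maxSynthPendingDepth 3

variable {E : Type*} [NormedAddCommGroup E] [NormedSpace ℝ E] [FiniteDimensional ℝ E]
  {H : Type*} [TopologicalSpace H] {I : ModelWithCorners ℝ E H}
  {M : Type*} [TopologicalSpace M] [ChartedSpace H M] [IsManifold I ∞ M] {x₀ x₁ x₂ x : M}

omit [FiniteDimensional ℝ E] in
lemma contMDiffAt_toCoord_comp_ofCoord (h₀ : x ∈ (extChartAt I x₀).source)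
    (h₁ : x ∈ (extChartAt I x₁).source) :
    ContMDiffAt I 𝓘(ℝ, E →L[ℝ] E) ∞ (fun z ↦ toCoord I x₀ z ∘L ofCoord I x₁ z) x := by
  refine (contMDiffAt_coordChangeL (IB := I) (n := ∞)
    (e := trivializationAt E (fun z : M ↦ TangentSpace I z) x₁)
    (e' := trivializationAt E (fun z : M ↦ TangentSpace I z) x₀)
    (mem_baseSet_of_mem_source h₁) (mem_baseSet_of_mem_source h₀)).congr_of_eventuallyEq ?_
  filter_upwards [(isOpen_extChartAt_source x₀).mem_nhds h₀,
    (isOpen_extChartAt_source x₁).mem_nhds h₁] with z hz₀ hz₁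
  ext v
  rw [ContinuousLinearMap.comp_apply, toCoord_apply hz₀, ofCoord_apply hz₁]
  exact (Bundle.Trivialization.coordChangeL_apply _ _
    ⟨mem_baseSet_of_mem_source hz₁, mem_baseSet_of_mem_source hz₀⟩ v).symm

omit [FiniteDimensional ℝ E] in
lemma contMDiffAt_extChartAt_symm [I.Boundaryless] {p : E} (hp : p ∈ (extChartAt I x₀).target) :
    ContMDiffAt 𝓘(ℝ, E) I ∞ (extChartAt I x₀).symm p :=
  (contMDiffOn_extChartAt_symm x₀).contMDiffAt ((isOpen_extChartAt_target x₀).mem_nhds hp)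

variable (I) in
/-- The change from the chart at `x₂` to the chart at `x₁` of the coordinates of tangent vectors, as
a function of the coordinates of the base point in the chart at `x₀`. -/
def coordChange (x₁ x₂ x₀ : M) (p : E) : E →L[ℝ] E :=
  toCoord I x₁ ((extChartAt I x₀).symm p) ∘L ofCoord I x₂ ((extChartAt I x₀).symm p)

omit [FiniteDimensional ℝ E] in
lemma coordChange_extChartAt (hx : x ∈ (extChartAt I x₀).source) (v : E) :
    coordChange I x₁ x₂ x₀ (extChartAt I x₀ x) v = toCoord I x₁ x (ofCoord I x₂ x v) := by
  rw [coordChange, (extChartAt I x₀).left_inv hx]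
  rfl

omit [FiniteDimensional ℝ E] in
lemma contDiffAt_coordChange [I.Boundaryless] (h₀ : x ∈ (extChartAt I x₀).source)
    (h₁ : x ∈ (extChartAt I x₁).source) (h₂ : x ∈ (extChartAt I x₂).source) :
    ContDiffAt ℝ ∞ (coordChange I x₁ x₂ x₀) (extChartAt I x₀ x) := by
  have h : ContMDiffAt I 𝓘(ℝ, E →L[ℝ] E) ∞ (fun z ↦ toCoord I x₁ z ∘L ofCoord I x₂ z)
      ((extChartAt I x₀).symm (extChartAt I x₀ x)) := by
    rw [(extChartAt I x₀).left_inv h₀]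
    exact contMDiffAt_toCoord_comp_ofCoord h₁ h₂
  exact contMDiffAt_iff_contDiffAt.1
    (h.comp _ (contMDiffAt_extChartAt_symm ((extChartAt I x₀).map_source h₀)))

omit [FiniteDimensional ℝ E] in
lemma extendVec_eq_ofCoord {v : TangentSpace I x₁} (hx : x ∈ (extChartAt I x₁).source) :
    extendVec I v x = ofCoord I x₁ x (toCoord I x₁ x₁ v) := by
  rw [ofCoord_apply hx, toCoord_apply (mem_extChartAt_source x₁)]
  rfl

omit [FiniteDimensional ℝ E] in
lemma extendVec_self (v : TangentSpace I x) : extendVec I v x = v :=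
  FiberBundle.extend_apply_self E v

omit [FiniteDimensional ℝ E] in
lemma coordField_extendVec_self (v : TangentSpace I x₀) {p : E}
    (hp : p ∈ (extChartAt I x₀).target) :
    coordField I x₀ (extendVec I v) p = toCoord I x₀ x₀ v := by
  have hs := (extChartAt I x₀).map_target hp
  rw [coordField, extendVec_eq_ofCoord hs, toCoord_ofCoord hs]

omit [FiniteDimensional ℝ E] in
lemma coordField_extendVec_eventuallyEq [I.Boundaryless] (hx : x ∈ (extChartAt I x₀).source)
    (v : TangentSpace I x) :
    coordField I x₀ (extendVec I v) =ᶠ[nhds (extChartAt I x₀ x)]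
      fun p ↦ coordChange I x₀ x x₀ p (toCoord I x x v) := by
  have h1 : (extChartAt I x).source ∈ nhds ((extChartAt I x₀).symm (extChartAt I x₀ x)) := by
    rw [(extChartAt I x₀).left_inv hx]; exact extChartAt_source_mem_nhds x
  filter_upwards [(contMDiffAt_extChartAt_symm
    ((extChartAt I x₀).map_source hx)).continuousAt.preimage_mem_nhds h1] with p hp
  rw [coordField, extendVec_eq_ofCoord hp]
  rfl

omit [FiniteDimensional ℝ E] in
lemma differentiableAt_coordField_extendVec [I.Boundaryless] (hx : x ∈ (extChartAt I x₀).source)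
    (v : TangentSpace I x) :
    DifferentiableAt ℝ (coordField I x₀ (extendVec I v)) (extChartAt I x₀ x) :=
  (((contDiffAt_coordChange hx hx (mem_extChartAt_source x)).clm_apply
    contDiffAt_const).differentiableAt (by simp)).congr_of_eventuallyEq
      (coordField_extendVec_eventuallyEq hx v)

variable [RiemannianBundle (fun x : M ↦ TangentSpace I x)]

variable (I) in
/-- The Riemannian metric in the chart at `x₀`. -/
def coordMetric (x₀ : M) (p : E) : E →L[ℝ] E →L[ℝ] ℝ :=
  ContinuousLinearMap.bilinearComp (innerSL ℝ (E := TangentSpace I ((extChartAt I x₀).symm p)))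
    (ofCoord I x₀ ((extChartAt I x₀).symm p)) (ofCoord I x₀ ((extChartAt I x₀).symm p))

omit [FiniteDimensional ℝ E] in
lemma coordMetric_apply (p u v : E) : coordMetric I x₀ p u v =
    inner ℝ (ofCoord I x₀ ((extChartAt I x₀).symm p) u)
      (ofCoord I x₀ ((extChartAt I x₀).symm p) v) := rfl

omit [FiniteDimensional ℝ E] in
lemma coordMetric_extChartAt (hx : x ∈ (extChartAt I x₀).source) (u v : TangentSpace I x) :
    coordMetric I x₀ (extChartAt I x₀ x) (toCoord I x₀ x u) (toCoord I x₀ x v) = inner ℝ u v := by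
  rw [coordMetric_apply, (extChartAt I x₀).left_inv hx, ofCoord_toCoord hx, ofCoord_toCoord hx]

omit [FiniteDimensional ℝ E] in
lemma coordMetric_coordField (Y Z : Π x : M, TangentSpace I x) {p : E}
    (hp : p ∈ (extChartAt I x₀).target) :
    coordMetric I x₀ p (coordField I x₀ Y p) (coordField I x₀ Z p) =
      inner ℝ (Y ((extChartAt I x₀).symm p)) (Z ((extChartAt I x₀).symm p)) := by
  have hs := (extChartAt I x₀).map_target hp
  rw [coordMetric_apply, coordField, coordField, ofCoord_toCoord hs, ofCoord_toCoord hs]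

variable [IsContMDiffRiemannianBundle I ∞ E (fun x : M ↦ TangentSpace I x)] [I.Boundaryless]

variable (x₀) in
lemma isLocalMetric_coordMetric : IsLocalMetric (coordMetric I x₀) (extChartAt I x₀).target where
  isOpen := isOpen_extChartAt_target x₀
  contDiffAt := by
    intro p hp
    have hframe : ∀ u : E, ∀ q ∈ (extChartAt I x₀).target, ContMDiffAt 𝓘(ℝ, E) I.tangent ∞
        (fun q ↦ (TotalSpace.mk ((extChartAt I x₀).symm q)
          (ofCoord I x₀ ((extChartAt I x₀).symm q) u) : TangentBundle I M)) q := by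
      intro u q hq
      have hs := (extChartAt I x₀).map_target hq
      have h1 : ContMDiffAt I I.tangent ∞
          (fun z ↦ (TotalSpace.mk z (ofCoord I x₀ z u) : TangentBundle I M))
          ((extChartAt I x₀).symm q) := by
        refine ((trivializationAt E (fun z : M ↦ TangentSpace I z)
          x₀).contMDiffAt_section_iff (mem_baseSet_of_mem_source hs)).2 ?_
        refine contMDiffAt_const (c := u) |>.congr_of_eventuallyEq ?_
        filter_upwards [(isOpen_extChartAt_source x₀).mem_nhds hs] with z hz
        exact (toCoord_apply hz _).symm.trans (toCoord_ofCoord hz u)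
      exact h1.comp q (contMDiffAt_extChartAt_symm hq)
    have hon : ContDiffOn ℝ ∞ (coordMetric I x₀) (extChartAt I x₀).target :=
      contDiffOn_clm_apply.2 fun u ↦ contDiffOn_clm_apply.2 fun v q hq ↦
        (contMDiffAt_iff_contDiffAt.1 (ContMDiffAt.inner_bundle (IB := I) (F := E)
          (E := fun z : M ↦ TangentSpace I z) (hframe u q hq) (hframe v q hq))).contDiffWithinAt
    exact hon.contDiffAt ((isOpen_extChartAt_target x₀).mem_nhds hp)
  symm p _ u v := by rw [coordMetric_apply, coordMetric_apply, real_inner_comm]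
  pos p hp u hu := by
    rw [coordMetric_apply]
    refine real_inner_self_pos.2 fun h0 ↦ hu ?_
    rw [← toCoord_ofCoord ((extChartAt I x₀).map_target hp) u, h0, map_zero]

lemma mvfderiv_inner {Y Z : Π x : M, TangentSpace I x} (hx : x ∈ (extChartAt I x₀).source)
    (hY : DifferentiableAt ℝ (coordField I x₀ Y) (extChartAt I x₀ x))
    (hZ : DifferentiableAt ℝ (coordField I x₀ Z) (extChartAt I x₀ x)) (v : TangentSpace I x) :
    mvfderiv I (fun z ↦ inner ℝ (Y z) (Z z)) x v =
      fderiv ℝ (coordMetric I x₀) (extChartAt I x₀ x) (toCoord I x₀ x v) (toCoord I x₀ x (Y x))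
          (toCoord I x₀ x (Z x))
        + coordMetric I x₀ (extChartAt I x₀ x)
          (fderiv ℝ (coordField I x₀ Y) (extChartAt I x₀ x) (toCoord I x₀ x v))
          (toCoord I x₀ x (Z x))
        + coordMetric I x₀ (extChartAt I x₀ x) (toCoord I x₀ x (Y x))
          (fderiv ℝ (coordField I x₀ Z) (extChartAt I x₀ x) (toCoord I x₀ x v)) := by
  have hp := (extChartAt I x₀).map_source hx
  have hg := (isLocalMetric_coordMetric x₀).differentiableAt hp
  have h1 : HasFDerivAt
      (fun p ↦ coordMetric I x₀ p (coordField I x₀ Y p) (coordField I x₀ Z p)) _ _ :=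
    (hg.hasFDerivAt.clm_apply hY.hasFDerivAt).clm_apply hZ.hasFDerivAt
  have h2 : (fun p ↦ (inner ℝ (Y ((extChartAt I x₀).symm p)) (Z ((extChartAt I x₀).symm p)) : ℝ))
      =ᶠ[nhds (extChartAt I x₀ x)]
      (fun p ↦ coordMetric I x₀ p (coordField I x₀ Y p) (coordField I x₀ Z p)) :=
    Filter.eventually_of_mem ((isOpen_extChartAt_target x₀).mem_nhds hp) fun p hp ↦
      (coordMetric_coordField Y Z hp).symm
  have h3 := h1.congr_of_eventuallyEq h2
  rw [mvfderiv_eq_fderiv hx h3.differentiableAt, h3.fderiv, coordField_extChartAt Y hx,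
    coordField_extChartAt Z hx]
  simp only [add_apply, ContinuousLinearMap.comp_apply, ContinuousLinearMap.flip_apply]
  ring

/-- The Koszul expression is `2 g(∂_X Y + Γ(X, Y), Z)` in any chart; in particular it only depends
on the values of `X` and `Z` at the point. -/
lemma koszul_eq {X Y Z : Π x : M, TangentSpace I x} (hx : x ∈ (extChartAt I x₀).source)
    (hX : DifferentiableAt ℝ (coordField I x₀ X) (extChartAt I x₀ x))
    (hY : DifferentiableAt ℝ (coordField I x₀ Y) (extChartAt I x₀ x))
    (hZ : DifferentiableAt ℝ (coordField I x₀ Z) (extChartAt I x₀ x)) :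
    koszul I X Y Z x = 2 * coordMetric I x₀ (extChartAt I x₀ x)
      (fderiv ℝ (coordField I x₀ Y) (extChartAt I x₀ x) (toCoord I x₀ x (X x))
        + christoffel (coordMetric I x₀) (extChartAt I x₀ x) (toCoord I x₀ x (X x))
          (toCoord I x₀ x (Y x))) (toCoord I x₀ x (Z x)) := by
  have hp := (extChartAt I x₀).map_source hx
  have hg := isLocalMetric_coordMetric (I := I) x₀
  have := FiniteDimensional.complete ℝ E
  rw [koszul, mvfderiv_inner hx hY hZ, mvfderiv_inner hx hX hZ, mvfderiv_inner hx hX hY]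
  simp only [← coordMetric_extChartAt hx, toCoord_mlieBracket hx hX hY,
    toCoord_mlieBracket hx hX hZ, toCoord_mlieBracket hx hY hZ, map_add, map_sub,
    add_apply, sub_apply, hg.apply_christoffel hp]
  rw [hg.symm _ hp (toCoord I x₀ x (X x)) (fderiv ℝ (coordField I x₀ Z) _ _),
    hg.symm _ hp (toCoord I x₀ x (X x)) (fderiv ℝ (coordField I x₀ Y) _ _),
    hg.symm _ hp (toCoord I x₀ x (Y x)) (fderiv ℝ (coordField I x₀ Z) _ _)]
  ring

/-- The Levi-Civita connection in a chart: `∇_v Y = ∂_v Y + Γ(v, Y)`. -/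
lemma toCoord_leviCivita {Y : Π x : M, TangentSpace I x} (hx : x ∈ (extChartAt I x₀).source)
    (hY : DifferentiableAt ℝ (coordField I x₀ Y) (extChartAt I x₀ x)) (v : TangentSpace I x) :
    toCoord I x₀ x (leviCivita I Y x v) =
      fderiv ℝ (coordField I x₀ Y) (extChartAt I x₀ x) (toCoord I x₀ x v)
        + christoffel (coordMetric I x₀) (extChartAt I x₀ x) (toCoord I x₀ x v)
          (toCoord I x₀ x (Y x)) := by
  set w := fderiv ℝ (coordField I x₀ Y) (extChartAt I x₀ x) (toCoord I x₀ x v)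
        + christoffel (coordMetric I x₀) (extChartAt I x₀ x) (toCoord I x₀ x v)
          (toCoord I x₀ x (Y x)) with hw
  have h1 : leviCivita I Y x v = ofCoord I x₀ x w := by
    rw [leviCivita, ← (stdOrthonormalBasis ℝ (TangentSpace I x)).sum_repr' (ofCoord I x₀ x w)]
    refine Finset.sum_congr rfl fun i _ ↦ ?_
    rw [koszul_eq hx (differentiableAt_coordField_extendVec hx _) hY
      (differentiableAt_coordField_extendVec hx _), extendVec_self, extendVec_self, ← hw,
      real_inner_comm, ← coordMetric_extChartAt hx, toCoord_ofCoord hx]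
    congr 1
    ring
  rw [h1, toCoord_ofCoord hx]

end RiemannianCharts

/-! ### The induced connection and the second fundamental form in charts -/

noncomputable section MapCharts

set_option maxSynthPendingDepth 3

variable {E : Type*} [NormedAddCommGroup E] [NormedSpace ℝ E]
  {H : Type*} [TopologicalSpace H] (I : ModelWithCorners ℝ E H)
  {M : Type*} [TopologicalSpace M] [ChartedSpace H M]
  {E' : Type*} [NormedAddCommGroup E'] [NormedSpace ℝ E']
  {H' : Type*} [TopologicalSpace H'] (J : ModelWithCorners ℝ E' H')
  {N : Type*} [TopologicalSpace N] [ChartedSpace H' N]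

/-- The map `φ` in the charts at `x₀` and `φ x₀`. -/
def coordMap (φ : M → N) (x₀ : M) (p : E) : E' :=
  extChartAt J (φ x₀) (φ ((extChartAt I x₀).symm p))

/-- The points of the chart at `x₀` which `φ` maps into the chart at `φ x₀`. -/
def coordDomain (φ : M → N) (x₀ : M) : Set E :=
  (extChartAt I x₀).target ∩ (extChartAt I x₀).symm ⁻¹' (φ ⁻¹' (extChartAt J (φ x₀)).source)

/-- The expression, in the charts at `x₀` and `φ x₀`, of a vector field `V` along `φ`. -/
def coordFieldAlong [IsManifold J ∞ N] (φ : M → N) (V : Π x : M, TangentSpace J (φ x)) (x₀ : M)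
    (p : E) : E' :=
  toCoord J (φ x₀) (φ ((extChartAt I x₀).symm p)) (V ((extChartAt I x₀).symm p))

variable {I J} {φ : M → N} {x₀ x : M}

lemma isOpen_coordDomain [I.Boundaryless] (hφ : Continuous φ) :
    IsOpen (coordDomain I J φ x₀) :=
  (continuousOn_extChartAt_symm x₀).isOpen_inter_preimage (isOpen_extChartAt_target x₀)
    ((isOpen_extChartAt_source (φ x₀)).preimage hφ)

lemma extChartAt_mem_coordDomain (hx : x ∈ (extChartAt I x₀).source)
    (hy : φ x ∈ (extChartAt J (φ x₀)).source) : extChartAt I x₀ x ∈ coordDomain I J φ x₀ :=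
  ⟨(extChartAt I x₀).map_source hx, by
    rwa [Set.mem_preimage, Set.mem_preimage, (extChartAt I x₀).left_inv hx]⟩

lemma coordMap_extChartAt (hx : x ∈ (extChartAt I x₀).source) :
    coordMap I J φ x₀ (extChartAt I x₀ x) = extChartAt J (φ x₀) (φ x) := by
  rw [coordMap, (extChartAt I x₀).left_inv hx]

/-- To prove a pointwise statement on the domain of the coordinate expression of `φ`, it suffices to
consider the points `extChartAt I x₀ x`. -/
lemma forall_mem_coordDomain {P : E → Prop} (h : ∀ x ∈ (extChartAt I x₀).source,
    φ x ∈ (extChartAt J (φ x₀)).source → P (extChartAt I x₀ x)) :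
    ∀ p ∈ coordDomain I J φ x₀, P p := by
  rintro p ⟨hp, hp'⟩
  rw [← (extChartAt I x₀).right_inv hp]
  exact h _ ((extChartAt I x₀).map_target hp) hp'

variable [IsManifold I ∞ M] [IsManifold J ∞ N]

omit [IsManifold I ∞ M] in
lemma coordFieldAlong_extChartAt (V : Π x : M, TangentSpace J (φ x))
    (hx : x ∈ (extChartAt I x₀).source) :
    coordFieldAlong I J φ V x₀ (extChartAt I x₀ x) = toCoord J (φ x₀) (φ x) (V x) := by
  rw [coordFieldAlong, (extChartAt I x₀).left_inv hx]

lemma contDiffAt_coordMap [I.Boundaryless] (hφ : ContMDiff I J ∞ φ)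
    (hx : x ∈ (extChartAt I x₀).source) (hy : φ x ∈ (extChartAt J (φ x₀)).source) :
    ContDiffAt ℝ ∞ (coordMap I J φ x₀) (extChartAt I x₀ x) := by
  have h1 : ContMDiffAt J 𝓘(ℝ, E') ∞ (extChartAt J (φ x₀))
      (φ ((extChartAt I x₀).symm (extChartAt I x₀ x))) := by
    rw [(extChartAt I x₀).left_inv hx]
    exact contMDiffAt_extChartAt' (by simpa using hy)
  have h2 : ContMDiffAt 𝓘(ℝ, E) J ∞ (fun p ↦ φ ((extChartAt I x₀).symm p)) (extChartAt I x₀ x) :=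
    hφ.contMDiffAt.comp _ (contMDiffAt_extChartAt_symm ((extChartAt I x₀).map_source hx))
  exact contMDiffAt_iff_contDiffAt.1 (ContMDiffAt.comp (extChartAt I x₀ x)
    (g := extChartAt J (φ x₀)) (f := fun p ↦ φ ((extChartAt I x₀).symm p)) h1 h2)

lemma fderiv_coordMap [I.Boundaryless] (hφ : ContMDiff I J ∞ φ)
    (hx : x ∈ (extChartAt I x₀).source) (hy : φ x ∈ (extChartAt J (φ x₀)).source)
    (v : TangentSpace I x) :
    fderiv ℝ (coordMap I J φ x₀) (extChartAt I x₀ x) (toCoord I x₀ x v) =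
      toCoord J (φ x₀) (φ x) (mfderiv I J φ x v) := by
  have h1 : MDifferentiableAt J 𝓘(ℝ, E') (extChartAt J (φ x₀)) (φ x) :=
    mdifferentiableAt_extChartAt (by simpa using hy)
  have h2 := mvfderiv_eq_fderiv (F := fun z ↦ extChartAt J (φ x₀) (φ z)) hx
    ((contDiffAt_coordMap hφ hx hy).differentiableAt (by simp)) v
  have h3 : mfderiv I 𝓘(ℝ, E') (fun z ↦ extChartAt J (φ x₀) (φ z)) x = _ :=
    mfderiv_comp x h1 (hφ.mdifferentiableAt (by simp))
  rw [mvfderiv, h3] at h2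
  rw [toCoord_eq_mfderiv hy]
  exact h2.symm

variable [I.Boundaryless] [J.Boundaryless] [FiniteDimensional ℝ E']
  [RiemannianBundle (fun y : N ↦ TangentSpace J y)]
  [IsContMDiffRiemannianBundle J ∞ E' (fun y : N ↦ TangentSpace J y)]

/-- The induced connection in charts. Its definition at `x` refers to the preferred chart at `φ x`;
the change to the chart at `φ x₀` differentiates the coordinate change once, and the same term
occurs when the constant extension in the preferred chart is differentiated on `N`. -/
lemma toCoord_pullbackConnection (hφ : ContMDiff I J ∞ φ) {V : Π x : M, TangentSpace J (φ x)}
    (hx : x ∈ (extChartAt I x₀).source) (hy : φ x ∈ (extChartAt J (φ x₀)).source)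
    (hV : DifferentiableAt ℝ (coordFieldAlong I J φ V x₀) (extChartAt I x₀ x))
    (v : TangentSpace I x) :
    toCoord J (φ x₀) (φ x) (pullbackConnection I J φ V x v) =
      covDerivAlong (christoffel (coordMetric J (φ x₀))) (coordMap I J φ x₀)
        (coordFieldAlong I J φ V x₀) (extChartAt I x₀ x) (toCoord I x₀ x v) := by
  have hp := (extChartAt I x₀).map_source hx
  have hyy := mem_extChartAt_source (I := J) (φ x)
  have hli := (extChartAt I x₀).left_inv hx
  have hly := (extChartAt J (φ x₀)).left_inv hy
  set p := extChartAt I x₀ x with hpdef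
  set q := extChartAt J (φ x₀) (φ x) with hqdef
  set T := coordChange J (φ x₀) (φ x) (φ x₀)
  set T' := coordChange J (φ x) (φ x₀) (φ x₀)
  have hq := (extChartAt J (φ x₀)).map_source hy
  have hT : DifferentiableAt ℝ T q := (contDiffAt_coordChange hy hy hyy).differentiableAt (by simp)
  have hT' : DifferentiableAt ℝ T' q :=
    (contDiffAt_coordChange hy hyy hy).differentiableAt (by simp)
  have hfp : coordMap I J φ x₀ p = q := coordMap_extChartAt hx
  have hf : DifferentiableAt ℝ (coordMap I J φ x₀) p :=
    (contDiffAt_coordMap hφ hx hy).differentiableAt (by simp)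
  -- `W` is the expression of `V` in the preferred chart at `φ x`.
  set W : M → E' := fun z ↦ (trivializationAt E' (fun y : N ↦ TangentSpace J y) (φ x)
        (TotalSpace.mk' E' (φ z) (V z))).2 with hW
  have hnear : ∀ᶠ p' in nhds p, φ ((extChartAt I x₀).symm p') ∈ (extChartAt J (φ x₀)).source ∧
      φ ((extChartAt I x₀).symm p') ∈ (extChartAt J (φ x)).source := by
    have hc : ContinuousAt (fun p' ↦ φ ((extChartAt I x₀).symm p')) p :=
      hφ.continuous.continuousAt.comp (contMDiffAt_extChartAt_symm hp).continuousAt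
    have h1 : (extChartAt J (φ x₀)).source ∩ (extChartAt J (φ x)).source ∈
        nhds (φ ((extChartAt I x₀).symm p)) := by
      rw [hli]
      exact ((isOpen_extChartAt_source _).inter (isOpen_extChartAt_source _)).mem_nhds ⟨hy, hyy⟩
    exact hc h1
  have hWV : (fun p' ↦ W ((extChartAt I x₀).symm p')) =ᶠ[nhds p]
      fun p' ↦ T' (coordMap I J φ x₀ p') (coordFieldAlong I J φ V x₀ p') := by
    filter_upwards [hnear] with p' hp'
    rw [coordMap, coordChange_extChartAt hp'.1, coordFieldAlong, ofCoord_toCoord hp'.1,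
      toCoord_apply hp'.2]
  have hVW : coordFieldAlong I J φ V x₀ =ᶠ[nhds p]
      fun p' ↦ T (coordMap I J φ x₀ p') (W ((extChartAt I x₀).symm p')) := by
    filter_upwards [hnear] with p' hp'
    rw [coordMap, coordChange_extChartAt hp'.1, coordFieldAlong,
      show W _ = _ from (toCoord_apply hp'.2 _).symm, ofCoord_toCoord hp'.2]
  rw [← hfp] at hT hT'
  have hWd : DifferentiableAt ℝ (fun p' ↦ W ((extChartAt I x₀).symm p')) p :=
    ((hT'.comp p hf).clm_apply hV).congr_of_eventuallyEq hWV
  have hVd : HasFDerivAt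
      (fun p' ↦ T (coordMap I J φ x₀ p') (W ((extChartAt I x₀).symm p'))) _ p :=
    (hT.hasFDerivAt.comp p hf.hasFDerivAt).clm_apply hWd.hasFDerivAt
  have hWx : W x = toCoord J (φ x) (φ x) (V x) := (toCoord_apply hyy _).symm
  have hext : coordField J (φ x₀) (extendVec J (V x)) =ᶠ[nhds q] fun q' ↦ T q' (W x) := by
    rw [hWx]
    exact coordField_extendVec_eventuallyEq hy (V x)
  have hextd : HasFDerivAt (fun q' ↦ T q' (W x)) _ (coordMap I J φ x₀ p) :=
    hT.hasFDerivAt.clm_apply (hasFDerivAt_const (W x) _)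
  rw [hfp] at hextd
  have h1 : toCoord J (φ x₀) (φ x)
      ((trivializationAt E' (fun y : N ↦ TangentSpace J y) (φ x)).symm (φ x)
        (mvfderiv I W x v)) =
      T q (fderiv ℝ (fun p' ↦ W ((extChartAt I x₀).symm p')) p (toCoord I x₀ x v)) := by
    rw [mvfderiv_eq_fderiv hx hWd, ← ofCoord_apply hyy, hqdef, coordChange_extChartAt hy]
  have h2 := toCoord_leviCivita hy (differentiableAt_coordField_extendVec hy (V x))
    (mfderiv I J φ x v)
  rw [← hqdef, hext.fderiv_eq, hextd.fderiv, extendVec_self, ← fderiv_coordMap hφ hx hy,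
    ← hpdef] at h2
  rw [pullbackConnection, map_add, h1, h2, covDerivAlong_apply, hVW.fderiv_eq, hVd.fderiv, hfp,
    coordFieldAlong_extChartAt V hx]
  simp only [Function.comp_apply, hfp, hli]
  simp
  abel

end MapCharts

/-! ### Isometric immersions in charts -/

noncomputable section ImmersionCharts

set_option maxSynthPendingDepth 3

lemma IsLocalMetric.mono {E : Type*} [NormedAddCommGroup E] [NormedSpace ℝ E]
    {g : E → E →L[ℝ] E →L[ℝ] ℝ} {Ω₁ Ω₂ : Set E} (hg : IsLocalMetric g Ω₂) (ho : IsOpen Ω₁)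
    (hs : Ω₁ ⊆ Ω₂) : IsLocalMetric g Ω₁ where
  isOpen := ho
  contDiffAt p hp := hg.contDiffAt p (hs hp)
  symm p hp := hg.symm p (hs hp)
  pos p hp := hg.pos p (hs hp)

lemma covDerivAlong_congr {E E' : Type*} [NormedAddCommGroup E] [NormedSpace ℝ E]
    [NormedAddCommGroup E'] [NormedSpace ℝ E'] {Γ : E' → E' →L[ℝ] E' →L[ℝ] E'} {f V W : E → E'}
    {p : E} (hVW : V =ᶠ[nhds p] W) : covDerivAlong Γ f V p = covDerivAlong Γ f W p := by
  rw [covDerivAlong, covDerivAlong, hVW.fderiv_eq, hVW.self_of_nhds]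

variable {E : Type*} [NormedAddCommGroup E] [NormedSpace ℝ E] [FiniteDimensional ℝ E]
  {H : Type*} [TopologicalSpace H] {I : ModelWithCorners ℝ E H} [I.Boundaryless]
  {M : Type*} [TopologicalSpace M] [ChartedSpace H M] [IsManifold I ∞ M]
  [RiemannianBundle (fun x : M ↦ TangentSpace I x)]
  [IsContMDiffRiemannianBundle I ∞ E (fun x : M ↦ TangentSpace I x)]
  {E' : Type*} [NormedAddCommGroup E'] [NormedSpace ℝ E'] [FiniteDimensional ℝ E']
  {H' : Type*} [TopologicalSpace H'] {J : ModelWithCorners ℝ E' H'} [J.Boundaryless]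
  {N : Type*} [TopologicalSpace N] [ChartedSpace H' N] [IsManifold J ∞ N]
  [RiemannianBundle (fun y : N ↦ TangentSpace J y)]
  [IsContMDiffRiemannianBundle J ∞ E' (fun y : N ↦ TangentSpace J y)]
  {φ : M → N} {x₀ x : M}

section Basis

omit [FiniteDimensional ℝ E] [I.Boundaryless]
  [IsContMDiffRiemannianBundle I ∞ E (fun x : M ↦ TangentSpace I x)]

/-- The coordinates of an orthonormal basis of `T_x M` in the chart at `x₀`. -/
def coordBasis {ι : Type*} [Fintype ι] (hx : x ∈ (extChartAt I x₀).source)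
    (e : OrthonormalBasis ι ℝ (TangentSpace I x)) : Basis ι ℝ E :=
  e.toBasis.map (LinearEquiv.ofLinearMap (toCoord I x₀ x).toLinearMap (ofCoord I x₀ x).toLinearMap
    (LinearMap.ext (toCoord_ofCoord hx)) (LinearMap.ext (ofCoord_toCoord hx)))

lemma coordBasis_apply {ι : Type*} [Fintype ι] (hx : x ∈ (extChartAt I x₀).source)
    (e : OrthonormalBasis ι ℝ (TangentSpace I x)) (i : ι) :
    coordBasis hx e i = toCoord I x₀ x (e i) := by
  simp [coordBasis]

lemma coordMetric_coordBasis {ι : Type*} [Fintype ι] [DecidableEq ι]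
    (hx : x ∈ (extChartAt I x₀).source) (e : OrthonormalBasis ι ℝ (TangentSpace I x)) (i j : ι) :
    coordMetric I x₀ (extChartAt I x₀ x) (coordBasis hx e i) (coordBasis hx e j) =
      if i = j then 1 else 0 := by
  rw [coordBasis_apply, coordBasis_apply, coordMetric_extChartAt hx]
  exact orthonormal_iff_ite.1 e.orthonormal i j

end Basis

omit [FiniteDimensional ℝ E] [FiniteDimensional ℝ E']

lemma isLocalIsometricImmersion_coordMap [FiniteDimensional ℝ E] [FiniteDimensional ℝ E']
    (hφ : IsIsometricImmersion I J φ) (x₀ : M) :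
    IsLocalIsometricImmersion (coordMetric I x₀) (coordDomain I J φ x₀) (coordMetric J (φ x₀))
      (extChartAt J (φ x₀)).target (coordMap I J φ x₀) where
  source := (isLocalMetric_coordMetric x₀).mono (isOpen_coordDomain hφ.contMDiff.continuous)
    Set.inter_subset_left
  target := isLocalMetric_coordMetric (φ x₀)
  mapsTo _ hp := (extChartAt J (φ x₀)).map_source hp.2
  contDiffAt := forall_mem_coordDomain fun _ hx hy ↦ contDiffAt_coordMap hφ.contMDiff hx hy
  isometry := forall_mem_coordDomain fun x hx hy u v ↦ by
    rw [coordMap_extChartAt hx, ← toCoord_ofCoord hx u, ← toCoord_ofCoord hx v,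
      fderiv_coordMap hφ.contMDiff hx hy, fderiv_coordMap hφ.contMDiff hx hy,
      coordMetric_extChartAt hy, coordMetric_extChartAt hx, hφ.inner_mfderiv]

omit [RiemannianBundle (fun x : M ↦ TangentSpace I x)]
  [IsContMDiffRiemannianBundle I ∞ E (fun x : M ↦ TangentSpace I x)] [J.Boundaryless]
  [RiemannianBundle (fun y : N ↦ TangentSpace J y)]
  [IsContMDiffRiemannianBundle J ∞ E' (fun y : N ↦ TangentSpace J y)] in
lemma coordFieldAlong_mfderiv (hφ : ContMDiff I J ∞ φ) (Y : Π x : M, TangentSpace I x) :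
    ∀ p ∈ coordDomain I J φ x₀, coordFieldAlong I J φ (fun z ↦ mfderiv I J φ z (Y z)) x₀ p =
      fderiv ℝ (coordMap I J φ x₀) p (coordField I x₀ Y p) :=
  forall_mem_coordDomain fun x hx hy ↦ by
    rw [coordFieldAlong_extChartAt _ hx, coordField_extChartAt _ hx, fderiv_coordMap hφ hx hy]

variable [FiniteDimensional ℝ E] [FiniteDimensional ℝ E']

lemma toCoord_secondFundamentalForm (hφ : IsIsometricImmersion I J φ)
    (hx : x ∈ (extChartAt I x₀).source) (hy : φ x ∈ (extChartAt J (φ x₀)).source)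
    (v w : TangentSpace I x) :
    toCoord J (φ x₀) (φ x) (secondFundamentalForm I J φ x v w) =
      localSecondForm (christoffel (coordMetric I x₀)) (christoffel (coordMetric J (φ x₀)))
        (coordMap I J φ x₀) (extChartAt I x₀ x) (toCoord I x₀ x v) (toCoord I x₀ x w) := by
  have L := isLocalIsometricImmersion_coordMap hφ x₀
  have hp := extChartAt_mem_coordDomain hx hy
  have hW := differentiableAt_coordField_extendVec hx w
  have hev : coordFieldAlong I J φ (fun z ↦ mfderiv I J φ z (extendVec I w z)) x₀
      =ᶠ[nhds (extChartAt I x₀ x)]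
      fun p ↦ fderiv ℝ (coordMap I J φ x₀) p (coordField I x₀ (extendVec I w) p) :=
    Filter.eventually_of_mem (L.source.mem_nhds hp) (coordFieldAlong_mfderiv hφ.contMDiff _)
  have hV : DifferentiableAt ℝ
      (fun p ↦ fderiv ℝ (coordMap I J φ x₀) p (coordField I x₀ (extendVec I w) p))
      (extChartAt I x₀ x) :=
    ((L.contDiffAt_fderiv hp).differentiableAt (by simp)).clm_apply hW
  rw [secondFundamentalForm, map_sub,
    toCoord_pullbackConnection hφ.contMDiff hx hy (hV.congr_of_eventuallyEq hev),
    covDerivAlong_congr hev, L.covDerivAlong_fderiv_apply hp hW,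
    ← fderiv_coordMap hφ.contMDiff hx hy, toCoord_leviCivita hx hW, coordField_extChartAt _ hx,
    extendVec_self, add_sub_cancel_right]

lemma coordFieldAlong_tensionField (hφ : IsIsometricImmersion I J φ) (x₀ : M) :
    ∀ p ∈ coordDomain I J φ x₀, coordFieldAlong I J φ (tensionField I J φ) x₀ p =
      localTension (finBasis ℝ E) (coordMetric I x₀) (christoffel (coordMetric J (φ x₀)))
        (coordMap I J φ x₀) p := by
  refine forall_mem_coordDomain fun x hx hy ↦ ?_
  have L := isLocalIsometricImmersion_coordMap hφ x₀
  rw [coordFieldAlong_extChartAt _ hx, tensionField, map_sum, L.localTension_eq_sum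
    (extChartAt_mem_coordDomain hx hy) _ _
    (coordMetric_coordBasis hx (stdOrthonormalBasis ℝ (TangentSpace I x)))]
  simp only [toCoord_secondFundamentalForm hφ hx hy, coordBasis_apply]

lemma toCoord_curvature (u v w : TangentSpace I x₀) :
    toCoord I x₀ x₀ (curvature I x₀ u v w) =
      riemann (christoffel (coordMetric I x₀)) (extChartAt I x₀ x₀) (toCoord I x₀ x₀ u)
        (toCoord I x₀ x₀ v) (toCoord I x₀ x₀ w) := by
  have := FiniteDimensional.complete ℝ E
  have hx := mem_extChartAt_source (I := I) x₀
  have hp := (extChartAt I x₀).map_source hx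
  have ht := (isOpen_extChartAt_target (I := I) x₀).mem_nhds hp
  have hg := isLocalMetric_coordMetric (I := I) x₀
  -- In the chart at `x₀`, the extensions of tangent vectors at `x₀` are constant.
  have hconst : ∀ a : TangentSpace I x₀, ∀ p ∈ (extChartAt I x₀).target,
      HasFDerivAt (coordField I x₀ (extendVec I a)) (0 : E →L[ℝ] E) p := fun a p hp ↦
    (hasFDerivAt_const (toCoord I x₀ x₀ a) p).congr_of_eventuallyEq
      (Filter.eventually_of_mem ((isOpen_extChartAt_target x₀).mem_nhds hp)
        fun q hq ↦ coordField_extendVec_self a hq)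
  have hnabla : ∀ a : TangentSpace I x₀,
      coordField I x₀ (fun z ↦ leviCivita I (extendVec I w) z (extendVec I a z))
        =ᶠ[nhds (extChartAt I x₀ x₀)] fun p ↦ christoffel (coordMetric I x₀) p
          (toCoord I x₀ x₀ a) (toCoord I x₀ x₀ w) := fun a ↦ by
    refine Filter.eventually_of_mem ht fun p hp ↦ ?_
    obtain ⟨x, hx, rfl⟩ : ∃ x ∈ (extChartAt I x₀).source, extChartAt I x₀ x = p :=
      ⟨_, (extChartAt I x₀).map_target hp, (extChartAt I x₀).right_inv hp⟩
    rw [coordField_extChartAt _ hx, toCoord_leviCivita hx (hconst w _ hp).differentiableAt,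
      (hconst w _ hp).fderiv, ← coordField_extChartAt _ hx, ← coordField_extChartAt _ hx,
      coordField_extendVec_self a hp, coordField_extendVec_self w hp]
    simp
  have hd : ∀ a : TangentSpace I x₀, HasFDerivAt (fun p ↦ christoffel (coordMetric I x₀) p
      (toCoord I x₀ x₀ a) (toCoord I x₀ x₀ w)) _ (extChartAt I x₀ x₀) := fun a ↦
    ((hg.differentiableAt_christoffel hp).hasFDerivAt.clm_apply
      (hasFDerivAt_const (toCoord I x₀ x₀ a) _)).clm_apply
      (hasFDerivAt_const (toCoord I x₀ x₀ w) _)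
  have hsecond : ∀ a b : TangentSpace I x₀, toCoord I x₀ x₀
      (leviCivita I (fun z ↦ leviCivita I (extendVec I w) z (extendVec I a z)) x₀ b) =
      fderiv ℝ (christoffel (coordMetric I x₀)) (extChartAt I x₀ x₀) (toCoord I x₀ x₀ b)
        (toCoord I x₀ x₀ a) (toCoord I x₀ x₀ w)
      + christoffel (coordMetric I x₀) (extChartAt I x₀ x₀) (toCoord I x₀ x₀ b)
        (christoffel (coordMetric I x₀) (extChartAt I x₀ x₀) (toCoord I x₀ x₀ a)
          (toCoord I x₀ x₀ w)) := fun a b ↦ by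
    rw [toCoord_leviCivita hx ((hd a).congr_of_eventuallyEq (hnabla a)).differentiableAt,
      (hnabla a).fderiv_eq, (hd a).fderiv]
    have h1 := (hnabla a).self_of_nhds
    rw [coordField_extChartAt _ hx] at h1
    rw [h1]
    simp
  have hbracket : VectorField.mlieBracket I (extendVec I u) (extendVec I v) x₀ = 0 := by
    refine toCoord_injective hx ?_
    rw [toCoord_mlieBracket hx (hconst u _ hp).differentiableAt (hconst v _ hp).differentiableAt,
      (hconst u _ hp).fderiv, (hconst v _ hp).fderiv]
    simp
  have hzero : toCoord I x₀ x₀ (leviCivita I (extendVec I w) x₀ 0) = 0 := by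
    rw [toCoord_leviCivita hx (hconst w _ hp).differentiableAt]
    simp
  rw [curvature, hbracket, map_sub, map_sub, hsecond, hsecond, hzero, riemann]
  abel

lemma toCoord_secondCovDeriv (hφ : IsIsometricImmersion I J φ)
    {V : Π x : M, TangentSpace J (φ x)} {W : E → E'}
    (hVW : ∀ p ∈ coordDomain I J φ x₀, coordFieldAlong I J φ V x₀ p = W p)
    (hW : ∀ p ∈ coordDomain I J φ x₀, ContDiffAt ℝ ∞ W p) (v w : TangentSpace I x₀) :
    toCoord J (φ x₀) (φ x₀) (secondCovDeriv I J φ V x₀ v w) =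
      localSecondCovDeriv (christoffel (coordMetric I x₀)) (christoffel (coordMetric J (φ x₀)))
        (coordMap I J φ x₀) W (extChartAt I x₀ x₀) (toCoord I x₀ x₀ v) (toCoord I x₀ x₀ w) := by
  have L := isLocalIsometricImmersion_coordMap hφ x₀
  have hx := mem_extChartAt_source (I := I) x₀
  have hy := mem_extChartAt_source (I := J) (φ x₀)
  have hp := extChartAt_mem_coordDomain hx hy
  have hev : ∀ p ∈ coordDomain I J φ x₀, coordFieldAlong I J φ V x₀ =ᶠ[nhds p] W := fun p hp ↦
    Filter.eventually_of_mem (L.source.mem_nhds hp) hVW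
  have hd : ∀ p ∈ coordDomain I J φ x₀, DifferentiableAt ℝ (coordFieldAlong I J φ V x₀) p :=
    fun p hp ↦ ((hW p hp).differentiableAt (by simp)).congr_of_eventuallyEq (hev p hp)
  have hfirst : ∀ p ∈ coordDomain I J φ x₀, coordFieldAlong I J φ
      (fun z ↦ pullbackConnection I J φ V z (extendVec I w z)) x₀ p =
      covDerivAlong (christoffel (coordMetric J (φ x₀))) (coordMap I J φ x₀) W p
        (toCoord I x₀ x₀ w) := by
    refine forall_mem_coordDomain fun x hx hy ↦ ?_
    have hp := extChartAt_mem_coordDomain hx hy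
    rw [coordFieldAlong_extChartAt _ hx, toCoord_pullbackConnection hφ.contMDiff hx hy (hd _ hp),
      covDerivAlong_congr (hev _ hp), ← coordField_extChartAt _ hx,
      coordField_extendVec_self w hp.1]
  have hev' := Filter.eventually_of_mem (L.source.mem_nhds hp) hfirst
  have hd' : DifferentiableAt ℝ (fun p ↦ covDerivAlong (christoffel (coordMetric J (φ x₀)))
      (coordMap I J φ x₀) W p (toCoord I x₀ x₀ w)) (extChartAt I x₀ x₀) :=
    ((L.contDiffAt_covDerivAlong hp (hW _ hp)).clm_apply contDiffAt_const).differentiableAt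
      (by simp)
  have hconst : HasFDerivAt (coordField I x₀ (extendVec I w)) (0 : E →L[ℝ] E)
      (extChartAt I x₀ x₀) :=
    (hasFDerivAt_const (toCoord I x₀ x₀ w) _).congr_of_eventuallyEq
      (Filter.eventually_of_mem ((isOpen_extChartAt_target x₀).mem_nhds hp.1)
        fun q hq ↦ coordField_extendVec_self w hq)
  rw [secondCovDeriv, map_sub,
    toCoord_pullbackConnection hφ.contMDiff hx hy (hd'.congr_of_eventuallyEq hev'),
    toCoord_pullbackConnection hφ.contMDiff hx hy (hd _ hp), covDerivAlong_congr hev',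
    covDerivAlong_congr (hev _ hp), toCoord_leviCivita hx hconst.differentiableAt, hconst.fderiv,
    extendVec_self, localSecondCovDeriv]
  simp

/-- If the normal connection annihilates a field, its covariant derivative is tangential. -/
lemma exists_covDerivAlong_eq_fderiv (hφ : IsIsometricImmersion I J φ)
    {V : Π x : M, TangentSpace J (φ x)} {W : E → E'}
    (hVW : ∀ p ∈ coordDomain I J φ x₀, coordFieldAlong I J φ V x₀ p = W p)
    (hW : ∀ p ∈ coordDomain I J φ x₀, ContDiffAt ℝ ∞ W p)
    (hV : ∀ x v, normalConnection I J φ V x v = 0) :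
    ∀ p ∈ coordDomain I J φ x₀, ∀ u, ∃ a,
      covDerivAlong (christoffel (coordMetric J (φ x₀))) (coordMap I J φ x₀) W p u =
        fderiv ℝ (coordMap I J φ x₀) p a := by
  have L := isLocalIsometricImmersion_coordMap hφ x₀
  refine forall_mem_coordDomain fun x hx hy u ↦ ?_
  have hp := extChartAt_mem_coordDomain hx hy
  have hev : coordFieldAlong I J φ V x₀ =ᶠ[nhds (extChartAt I x₀ x)] W :=
    Filter.eventually_of_mem (L.source.mem_nhds hp) hVW
  have h1 := hV x (ofCoord I x₀ x u)
  rw [normalConnection, Submodule.starProjection_apply_eq_zero_iff, normalSpace,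
    Submodule.orthogonal_orthogonal] at h1
  obtain ⟨a, ha⟩ := h1
  refine ⟨toCoord I x₀ x a, ?_⟩
  rw [fderiv_coordMap hφ.contMDiff hx hy]
  have h2 := toCoord_pullbackConnection hφ.contMDiff hx hy
    (((hW _ hp).differentiableAt (by simp)).congr_of_eventuallyEq hev) (ofCoord I x₀ x u)
  rw [toCoord_ofCoord hx, covDerivAlong_congr hev, ← ha] at h2
  exact h2.symm

/-- The pointwise form of the characterization of biharmonic isometric immersions with parallel
tension field. -/
lemma bitensionField_eq_zero_iff (hφ : IsIsometricImmersion I J φ)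
    (hτ : ∀ x v, normalConnection I J φ (tensionField I J φ) x v = 0) {ι : Type*} [Fintype ι]
    (e : OrthonormalBasis ι ℝ (TangentSpace I x₀)) :
    bitensionField I J φ x₀ = 0 ↔
      ∑ k, curvature J (φ x₀) (tensionField I J φ x₀) (mfderiv I J φ x₀ (e k))
          (mfderiv I J φ x₀ (e k)) =
        ∑ j, ∑ k, (inner ℝ (tensionField I J φ x₀) (secondFundamentalForm I J φ x₀ (e j) (e k))) •
          secondFundamentalForm I J φ x₀ (e j) (e k) := by
  classical
  have L := isLocalIsometricImmersion_coordMap hφ x₀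
  have hx := mem_extChartAt_source (I := I) x₀
  have hy := mem_extChartAt_source (I := J) (φ x₀)
  have hp := extChartAt_mem_coordDomain hx hy
  have hVW := coordFieldAlong_tensionField hφ x₀
  have hW := fun p hp ↦ L.contDiffAt_localTension (finBasis ℝ E) (p := p) hp
  have ht := exists_covDerivAlong_eq_fderiv hφ hVW hW hτ
  have hinj := toCoord_injective hy
  have hs := coordMetric_coordBasis hx (stdOrthonormalBasis ℝ (TangentSpace I x₀))
  have he := coordMetric_coordBasis hx e
  have key := L.neg_sum_localSecondCovDeriv_eq_iff (finBasis ℝ E) (coordBasis hx e) hp ht he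
  have hτ₀ := hVW _ hp
  rw [coordFieldAlong_extChartAt _ hx] at hτ₀
  have hy₀ : coordMap I J φ x₀ (extChartAt I x₀ x₀) = extChartAt J (φ x₀) (φ x₀) :=
    coordMap_extChartAt hx
  -- The traces in the definitions are over a fixed orthonormal basis.
  rw [L.sum_localSecondCovDeriv_eq hp _ he _ hs (hW _ hp) ht] at key
  nth_rewrite 1 [L.sum_riemann_eq hp _ he _ hs] at key
  rw [bitensionField, sub_eq_zero, ← hinj.eq_iff, ← hinj.eq_iff (a := ∑ k, _), roughLaplacian,
    curvatureOperator]
  simp only [← hτ₀, hy₀, coordBasis_apply, fderiv_coordMap hφ.contMDiff hx hy, ← toCoord_curvature,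
    ← toCoord_secondFundamentalForm hφ hx hy, coordMetric_extChartAt hy,
    ← toCoord_secondCovDeriv hφ hVW hW] at key
  simpa only [map_neg, map_sum, map_smul] using key

end ImmersionCharts

theorem theorem3p2 {m n : ℕ}
    {M : Type*} [TopologicalSpace M] [ChartedSpace (EuclideanSpace ℝ (Fin m)) M]
    [IsManifold (𝓡 m) ∞ M] [RiemannianBundle (fun x : M ↦ TangentSpace (𝓡 m) x)]
    [IsContMDiffRiemannianBundle (𝓡 m) ∞ (EuclideanSpace ℝ (Fin m))
      (fun x : M ↦ TangentSpace (𝓡 m) x)]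
    {N : Type*} [TopologicalSpace N] [ChartedSpace (EuclideanSpace ℝ (Fin n)) N]
    [IsManifold (𝓡 n) ∞ N] [RiemannianBundle (fun y : N ↦ TangentSpace (𝓡 n) y)]
    [IsContMDiffRiemannianBundle (𝓡 n) ∞ (EuclideanSpace ℝ (Fin n))
      (fun y : N ↦ TangentSpace (𝓡 n) y)]
    (φ : M → N) (hφ : IsIsometricImmersion (𝓡 m) (𝓡 n) φ)
    (hτ : ∀ (x : M) (v : TangentSpace (𝓡 m) x),
      normalConnection (𝓡 m) (𝓡 n) φ (tensionField (𝓡 m) (𝓡 n) φ) x v = 0)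
    (e : Π x : M, OrthonormalBasis (Fin m) ℝ (TangentSpace (𝓡 m) x)) :
    IsBiharmonic (𝓡 m) (𝓡 n) φ ↔
      ∀ x : M,
        ∑ k, curvature (𝓡 n) (φ x) (tensionField (𝓡 m) (𝓡 n) φ x)
            (mfderiv (𝓡 m) (𝓡 n) φ x (e x k)) (mfderiv (𝓡 m) (𝓡 n) φ x (e x k)) =
          ∑ j, ∑ k,
            (inner ℝ (tensionField (𝓡 m) (𝓡 n) φ x)
                (secondFundamentalForm (𝓡 m) (𝓡 n) φ x (e x j) (e x k))) •
              secondFundamentalForm (𝓡 m) (𝓡 n) φ x (e x j) (e x k) :=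
  forall_congr' fun x ↦ bitensionField_eq_zero_iff hφ hτ (e x)
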